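/- **Setting.** Let $d\in\{2,3\}$, let $\mathcal K_h$ be a conforming mesh of a polyhedral domain $\Omega\subset\mathbb R^d$ by finitely many nondegenerate simplices, and let $\mathcal E_h^I$ be the set of its interior faces. Each $e\in\mathcal E_h^I$ has a unit normal $n_e$ pointing from one neighbour $K_i$ to the other neighbour $K_j$; $[\psi]=\psi|_{K_i}-\psi|_{K_j}$, $\{\psi\}=\frac12(\psi|_{K_i}+\psi|_{K_j})$, and $h_e$ is the $(d-1)$-dimensional measure of $e$. Let $\mathcal V_h$ be the space of discontinuous piecewise affine vector fields, $\mathcal Q_h$ the space of piecewise constant functions, $\mathcal U_h\subset H(\mathrm{div},\Omega)$ the lowest-order Raviart–Thomas space and $\mathcal U_h^0=\{v\in\mathcal U_h: v\cdot n=0 \text{ on }\partial\Omega\}$. Let $R,T,\beta,\nu,\kappa^0,\eta>0$, $b\ge 0$, $0<\phi_r<1$, $\alpha\in\mathbb R$, and put $$f(c)=cRT\ln c-cRT\ln(1-\beta c)+\frac{bc}{2\sqrt2\,\beta}\ln\frac{1+(1-\sqrt2)\beta c}{1+(1+\sqrt2)\beta c},\qquad \mu(c)=f'(c),\qquad \lambda(\phi)=\frac{\kappa^0}{\nu}\Big(\frac{\phi}{\phi_r}\Big)^3\Big(\frac{1-\phi_r}{1-\phi}\Big)^2,$$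 $\varepsilon(u)=\frac12(\nabla u+\nabla u^T)$ and $\sigma_e(u)=2\eta\,\varepsilon(u)+\gamma(\nabla\cdot u)I$ on each element, and $$\begin{aligned}\mathcal A(u,p,v)={}&\sum_K(\sigma_e(u),\varepsilon(v))_K-\sum_{e\in\mathcal E_h^I}\langle\{\sigma_e(u)n_e\},[v]\rangle_e-\alpha\sum_K(p,\nabla\cdot v)_K+\alpha\sum_{e\in\mathcal E_h^I}\langle\{p\,n_e\},[v]\rangle_e\\&-\sum_{e\in\mathcal E_h^I}\langle[u],\{\sigma_e(v)n_e\}\rangle_e+\sum_{e\in\mathcal E_h^I}\frac{\varsigma_2}{h_e}\langle[u],[v]\rangle_e.\end{aligned}$$ Given the previous time level $(u_s^n,p^n,u_f^n,c^n,\phi^n)$ with $u_s^n\in\mathcal V_h$, $u_f^n\in\mathcal U_h$ and $p^n,c^n,\phi^n\in\mathcal Q_h$, let $c^{n*}=c^n|_{K_i}$ on $e$ if $u_f^n\cdot n_e\ge0$ and $c^{n*}=c^n|_{K_j}$ otherwise, and write $D_\tau X=(X-X^n)/\tau$. The *nonlinear system* asks for $u_s\in\mathcal V_h$, $u_f\in\mathcal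 U_h^0$ and $p,c,\mu,\phi\in\mathcal Q_h$ with $$\mu=\mu(c^n)+\theta RT\,\frac{c-c^n}{c^n(1-\beta c^n)^2}$$ such that, for all $v\in\mathcal V_h$, $w\in\mathcal U_h^0$ and $q,z,\varphi\in\mathcal Q_h$, $$\begin{aligned} &\mathcal A(u_s,p,v)=0,\\ &(D_\tau(\phi c),q)+\sum_{e\in\mathcal E_h^I}\langle c^{n*}u_f\cdot n_e,[q]\rangle_e+\sum_{e\in\mathcal E_h^I}\frac{\varsigma_1}{h_e}\langle[\mu],[q]\rangle_e=0,\\ &(\lambda^{-1}(\phi^n)u_f,w)=\sum_{e\in\mathcal E_h^I}\langle[\mu],c^{n*}w\cdot n_e\rangle_e,\\ &(p,z)=(c^n\mu-f(c^n),z),\\ &(D_\tau\phi,\varphi)=\frac1N(D_\tau p,\varphi)+\alpha(D_\tau(\nabla\cdot u_s),\varphi)-\alpha\sum_{e\in\mathcal E_h^I}\langle\{\varphi n_e\},[D_\tau u_s]\rangle_e. \end{aligned}$$ The *linear iteration* computes iterate $l+1$ from iterate $l$ by the same equations for the unknowns of level $l+1$, except that in the second equation $D_\tau(\phi c)$ is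 replaced by $(\phi^{l}c^{l+1}-\phi^nc^n)/\tau$ and $u_f$ by $u_f^{l}$. An *infinitesimal rigid displacement* is a field $r\in\mathcal V_h$ with $\varepsilon(r)=0$ in every element and $[r]=0$ on every interior face (if $\Omega$ is connected, $r(x)=a+Bx$ with $B^T=-B$). **Theorem.** Let $\varrho_0>0$, $\varrho<1$, $\phi_{\min}>0$, $\phi_{\max}<1$, $0<C_\epsilon<\min(\phi_{\min},1-\phi_{\max})$, and let $p_{\max},\theta_{\max},\tau_{\max},U_{\max}$ be real numbers. If $\gamma,N,\varsigma_1,\varsigma_2$ are large enough (that is, $\gamma\ge\gamma_0$, $N\ge N_0$, $\varsigma_1\ge\varsigma_{1,0}$ and $\varsigma_2\ge\varsigma_{2,0}(\gamma)$ for some positive thresholds depending only on the mesh with its choice of normals, the physical constants and the numbers just listed, where $\varsigma_{2,0}$ depends also on $\gamma$), then for all $\tau>0$, all $\theta\in[1,\theta_{\max}]$ and every previous level with $$\varrho_0\le\beta c^n\le\varrho,\qquad \phi_{\min}\le\phi^n\le\phi_{\max},\qquad |p^n|\le p_{\max},\qquad \mathcal A(u_s^n,p^n,v)=0\quad\forall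 v\in\mathcal V_h,$$ the following holds. 1. (Existence.) The nonlinear system has a solution $(u_s,p,u_f,c,\mu,\phi)$ with $|\phi-\phi^n|\le C_\epsilon$. 2. (Uniqueness.) Every solution of the nonlinear system that satisfies $\phi\ge\phi^n-C_\epsilon$ on $\Omega$, or $0<c<1/\beta$ on $\Omega$, has the same $p,u_f,c,\mu,\phi$, and its displacement differs from $u_s$ by an infinitesimal rigid displacement. 3. (Convergence.) If $\tau\le\tau_{\max}$, then for every initial guess with $|\phi^{0}-\phi^n|\le C_\epsilon$, $u_f^{0}\in\mathcal U_h^0$ and $\|u_f^{0}\|_{L^2}\le |U_{\max}|$, a sequence of linear iterates exists, and every such sequence satisfies $|\phi^l-\phi^n|\le C_\epsilon$ for all $l$ and converges to the solution in 1: $p^l,u_f^l,c^l,\mu^l,\phi^l$ converge in $L^2$ to $p,u_f,c,\mu,\phi$, and there are infinitesimal rigid displacements $r_l$ with $u_s^l-r_l\to u_s$ in $L^2$. -/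

import Mathlib

open MeasureTheory Filter Topology

noncomputable section

namespace PoroGas

/-- The ambient space `ℝᵈ` with its Euclidean structure. -/
abbrev E (d : ℕ) : Type := EuclideanSpace ℝ (Fin d)

/-! ### Meshes -/

/-- A conforming simplicial mesh of the polyhedral domain `Ω ⊆ ℝᵈ`: a finite simplicial complex,
all of whose simplices are faces of nondegenerate `d`-simplices, whose union fills `Ω`. -/
structure Triangulation (d : ℕ) (Ω : Set (E d)) where
  complex : Geometry.SimplicialComplex ℝ (E d)
  finite : complex.faces.Finite
  pure : ∀ s ∈ complex.faces, ∃ t ∈ complex.faces, s ⊆ t ∧ t.card = d + 1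
  fills : interior complex.space = Ω

variable {d : ℕ} {Ω : Set (E d)}

/-- The elements `K` of the mesh: its `d`-simplices, given by their vertices. -/
def Elem (M : Triangulation d Ω) : Type :=
  {s : Finset (E d) // s ∈ M.complex.faces ∧ s.card = d + 1}

/-- The interior faces (edges if `d = 2`): the `(d-1)`-simplices shared by two elements. -/
def IFace (M : Triangulation d Ω) : Type :=
  {e : Finset (E d) // e ∈ M.complex.faces ∧ e.card = d ∧
    ∃ K L : Elem M, K ≠ L ∧ e ⊆ K.1 ∧ e ⊆ L.1}

instance (M : Triangulation d Ω) : Finite (Elem M) :=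
  (M.finite.subset (fun _ h => h.1 :
    {s : Finset (E d) | s ∈ M.complex.faces ∧ s.card = d + 1} ⊆ M.complex.faces)).to_subtype

instance (M : Triangulation d Ω) : Finite (IFace M) :=
  (M.finite.subset (fun _ h => h.1 :
    {e : Finset (E d) | e ∈ M.complex.faces ∧ e.card = d ∧
      ∃ K L : Elem M, K ≠ L ∧ e ⊆ K.1 ∧ e ⊆ L.1} ⊆ M.complex.faces)).to_subtype

instance (M : Triangulation d Ω) : Fintype (Elem M) := Fintype.ofFinite _

instance (M : Triangulation d Ω) : Fintype (IFace M) := Fintype.ofFinite _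

/-- The closed simplex `K`. -/
def Elem.cell {M : Triangulation d Ω} (K : Elem M) : Set (E d) :=
  convexHull ℝ (K.1 : Set (E d))

/-- The closed face `e`. -/
def IFace.cell {M : Triangulation d Ω} (e : IFace M) : Set (E d) :=
  convexHull ℝ (e.1 : Set (E d))

/-- `n` is orthogonal to the hyperplane through the vertices of the face `e`. -/
def IsNormalTo (n : E d) (e : Finset (E d)) : Prop :=
  ∀ x ∈ e, ∀ y ∈ e, inner ℝ n (x - y) = 0

/-- A face of the element `K` lying on `∂Ω`: a `(d-1)`-face of `K` that belongs to no other
element. -/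
def IsBoundaryFace (M : Triangulation d Ω) (K : Elem M) (e : Finset (E d)) : Prop :=
  e ∈ M.complex.faces ∧ e.card = d ∧ e ⊆ K.1 ∧ ∀ L : Elem M, e ⊆ L.1 → L = K

/-- A numbering `(Kᵢ, Kⱼ)` of the two neighbours of every interior face `e`, together with the unit
normal `nₑ` of `e` pointing from `Kᵢ = fst e` to `Kⱼ = snd e`. -/
structure Orientation (M : Triangulation d Ω) where
  fst : IFace M → Elem M
  snd : IFace M → Elem M
  ne : ∀ e, fst e ≠ snd e
  sub_fst : ∀ e, e.1 ⊆ (fst e).1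
  sub_snd : ∀ e, e.1 ⊆ (snd e).1
  normal : IFace M → E d
  norm_normal : ∀ e, ‖normal e‖ = 1
  isNormal : ∀ e, IsNormalTo (normal e) e.1
  outward : ∀ e, ∀ x ∈ (fst e).1, ∀ y ∈ e.1, inner ℝ (normal e) (x - y) ≤ 0

/-- Integral over an element, `∫_K g dx`. -/
def intK {M : Triangulation d Ω} (K : Elem M) (g : E d → ℝ) : ℝ :=
  ∫ x in K.cell, g x

/-- Integral over a face with respect to `(d-1)`-dimensional surface measure, `∫_e g ds`. -/
def intF {M : Triangulation d Ω} (e : IFace M) (g : E d → ℝ) : ℝ :=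
  ∫ x in e.cell, g x ∂(Measure.euclideanHausdorffMeasure (d - 1))

/-- `hₑ`: the length of `e` if `d = 2`, the area of `e` if `d = 3`. -/
def hF {M : Triangulation d Ω} (e : IFace M) : ℝ :=
  ((Measure.euclideanHausdorffMeasure (d - 1) : Measure (E d)) e.cell).toReal

/-! ### Discrete spaces

A piecewise polynomial function is the family of its polynomial restrictions to the elements. -/

/-- `𝒬ₕ`: piecewise constant functions. -/
abbrev P0 (M : Triangulation d Ω) : Type := Elem M → ℝ

/-- `𝒱ₕ`: discontinuous piecewise affine vector fields. -/
abbrev P1 (M : Triangulation d Ω) : Type := Elem M → (E d →ᵃ[ℝ] E d)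

/-- `𝒰ₕ`: the lowest-order Raviart-Thomas space.  On each element the field has the form
`x ↦ a + b • x`, and it lies in `H(div, Ω)`: for piecewise polynomial fields this means that the
normal components of the two traces on each interior face agree. -/
def RT (M : Triangulation d Ω) : Submodule ℝ (P1 M) where
  carrier := {v | (∀ K, ∃ b : ℝ, ∀ x : E d, (v K).linear x = b • x) ∧
    ∀ (e : IFace M) (K L : Elem M), e.1 ⊆ K.1 → e.1 ⊆ L.1 → ∀ n : E d, IsNormalTo n e.1 →
      ∀ x ∈ e.cell, inner ℝ (v K x) n = inner ℝ (v L x) n}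
  zero_mem' := ⟨fun _ => ⟨0, fun x => by simp⟩, by intros; simp⟩
  add_mem' := by
    rintro v w ⟨hv, hv'⟩ ⟨hw, hw'⟩
    refine ⟨fun K => ?_, fun e K L hK hL n hn x hx => ?_⟩
    · obtain ⟨a, ha⟩ := hv K
      obtain ⟨b, hb⟩ := hw K
      exact ⟨a + b, fun x => by simp [ha x, hb x, add_smul]⟩
    · simp [inner_add_left, hv' e K L hK hL n hn x hx, hw' e K L hK hL n hn x hx]
  smul_mem' := by
    rintro c v ⟨hv, hv'⟩
    refine ⟨fun K => ?_, fun e K L hK hL n hn x hx => ?_⟩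
    · obtain ⟨a, ha⟩ := hv K
      exact ⟨c * a, fun x => by simp [ha x, mul_smul]⟩
    · simp [inner_smul_left, hv' e K L hK hL n hn x hx]

/-- `𝒰ₕ⁰`: the fields of `𝒰ₕ` with `v · n = 0` on `∂Ω`. -/
def RT0 (M : Triangulation d Ω) : Submodule ℝ (P1 M) where
  carrier := {v | v ∈ RT M ∧ ∀ (K : Elem M) (e : Finset (E d)), IsBoundaryFace M K e →
    ∀ n : E d, IsNormalTo n e → ∀ x ∈ convexHull ℝ (e : Set (E d)), inner ℝ (v K x) n = 0}
  zero_mem' := ⟨(RT M).zero_mem, by intros; simp⟩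
  add_mem' := by
    rintro v w ⟨hv, hv'⟩ ⟨hw, hw'⟩
    refine ⟨(RT M).add_mem hv hw, fun K e he n hn x hx => ?_⟩
    simp [inner_add_left, hv' K e he n hn x hx, hw' K e he n hn x hx]
  smul_mem' := by
    rintro c v ⟨hv, hv'⟩
    refine ⟨(RT M).smul_mem c hv, fun K e he n hn x hx => ?_⟩
    simp [inner_smul_left, hv' K e he n hn x hx]

/-- Squared `L²(Ω)`-norm of a piecewise affine field. -/
def l2SqV {M : Triangulation d Ω} (v : P1 M) : ℝ := ∑ K, intK K fun x => ‖v K x‖ ^ 2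

/-- Squared `L²(Ω)`-norm of a piecewise constant function. -/
def l2SqQ {M : Triangulation d Ω} (q : P0 M) : ℝ := ∑ K, intK K fun _ => q K ^ 2

/-! ### Elasticity -/

/-- The gradient (Jacobian matrix) of an affine field. -/
def grad (v : E d →ᵃ[ℝ] E d) : Matrix (Fin d) (Fin d) ℝ :=
  Matrix.of fun i j => v.linear (EuclideanSpace.single j 1) i

/-- The divergence `∇ · v`. -/
def divg (v : E d →ᵃ[ℝ] E d) : ℝ := (grad v).trace

/-- The strain `ε(v)`. -/
def strain (v : E d →ᵃ[ℝ] E d) : Matrix (Fin d) (Fin d) ℝ :=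
  (1 / 2 : ℝ) • (grad v + (grad v).transpose)

/-- The effective stress `σₑ(v) = 2 η ε(v) + γ (∇ · v) I`. -/
def stress (η γ : ℝ) (v : E d →ᵃ[ℝ] E d) : Matrix (Fin d) (Fin d) ℝ :=
  (2 * η) • strain v + (γ * divg v) • (1 : Matrix (Fin d) (Fin d) ℝ)

/-- The contraction `A : B`. -/
def frob (A B : Matrix (Fin d) (Fin d) ℝ) : ℝ := ∑ i, ∑ j, A i j * B i j

/-- The matrix-vector product `A n`. -/
def act (A : Matrix (Fin d) (Fin d) ℝ) (n : E d) : E d := WithLp.toLp 2 (A.mulVec n.ofLp)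

/-- The jump `[q] = q|_{Kᵢ} - q|_{Kⱼ}` of a piecewise constant function. -/
def jumpQ {M : Triangulation d Ω} (o : Orientation M) (q : P0 M) (e : IFace M) : ℝ :=
  q (o.fst e) - q (o.snd e)

/-- The jump `[v] = v|_{Kᵢ} - v|_{Kⱼ}` of a piecewise affine field, at a point of the face. -/
def jumpV {M : Triangulation d Ω} (o : Orientation M) (v : P1 M) (e : IFace M) (x : E d) : E d :=
  v (o.fst e) x - v (o.snd e) x

/-- The average `{q nₑ}`. -/
def avgN {M : Triangulation d Ω} (o : Orientation M) (q : P0 M) (e : IFace M) : E d :=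
  (1 / 2 : ℝ) • (q (o.fst e) • o.normal e + q (o.snd e) • o.normal e)

/-- The average `{σₑ(v) nₑ}`. -/
def avgStressN {M : Triangulation d Ω} (o : Orientation M) (η γ : ℝ) (v : P1 M) (e : IFace M) :
    E d :=
  (1 / 2 : ℝ) • (act (stress η γ (v (o.fst e))) (o.normal e) +
    act (stress η γ (v (o.snd e))) (o.normal e))

/-- Infinitesimal rigid displacements in `𝒱ₕ`: no strain inside the elements, no jump across
interior faces.  (On a connected domain these are the fields `x ↦ a + B x`, `Bᵀ = -B`.) -/
def IsRigid {M : Triangulation d Ω} (o : Orientation M) (w : P1 M) : Prop :=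
  (∀ K, strain (w K) = 0) ∧ ∀ e : IFace M, ∀ x ∈ e.cell, jumpV o w e x = 0

/-! ### Physical constants and constitutive laws -/

/-- Physical constants: gas constant `R`, temperature `T`, Peng-Robinson parameters `b = b(T)` and
`β`, viscosity `ν`, intrinsic permeability `κ₀`, reference porosity `φr`, shear modulus `η`, Biot
coefficient `α`. -/
structure Physical where
  R : ℝ
  T : ℝ
  b : ℝ
  β : ℝ
  ν : ℝ
  κ₀ : ℝ
  φr : ℝ
  η : ℝ
  α : ℝ
  R_pos : 0 < R
  T_pos : 0 < T
  b_nonneg : 0 ≤ b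
  β_pos : 0 < β
  ν_pos : 0 < ν
  κ₀_pos : 0 < κ₀
  φr_pos : 0 < φr
  φr_lt_one : φr < 1
  η_pos : 0 < η

/-- The Helmholtz free energy density `f(c)` of the Peng-Robinson equation of state. -/
def Physical.f (P : Physical) (c : ℝ) : ℝ :=
  c * P.R * P.T * Real.log c
    + (-(c * P.R * P.T * Real.log (1 - P.β * c)))
    + P.b * c / (2 * Real.sqrt 2 * P.β) *
        Real.log ((1 + (1 - Real.sqrt 2) * P.β * c) / (1 + (1 + Real.sqrt 2) * P.β * c))

/-- The chemical potential `μ(c) = f'(c)`. -/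
def Physical.mu (P : Physical) (c : ℝ) : ℝ := deriv P.f c

/-- The mobility `λ(φ) = κ(φ) / ν` with the Kozeny-Carman permeability `κ(φ)`. -/
def Physical.mob (P : Physical) (φ : ℝ) : ℝ :=
  P.κ₀ * (φ / P.φr) ^ 3 * ((1 - P.φr) / (1 - φ)) ^ 2 / P.ν

/-- Lamé parameter `γ`, Biot modulus `N`, penalty parameters `ς₁`, `ς₂`, time step `τ`,
stabilization parameter `θ`. -/
structure Tuning where
  γ : ℝ
  N : ℝ
  ς₁ : ℝ
  ς₂ : ℝ
  τ : ℝ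
  θ : ℝ

/-! ### The scheme -/

/-- One time level `(uₛ, p, u_f, c, μ, φ)` of discrete functions. -/
structure Level (M : Triangulation d Ω) where
  us : P1 M
  p : P0 M
  uf : P1 M
  c : P0 M
  mu : P0 M
  phi : P0 M

/-- The bilinear form `𝒜(uₛ, p, v)`. -/
def formA {M : Triangulation d Ω} (o : Orientation M) (P : Physical) (t : Tuning)
    (u : P1 M) (p : P0 M) (v : P1 M) : ℝ :=
  (∑ K, intK K fun _ => frob (stress P.η t.γ (u K)) (strain (v K)))
  - (∑ e, intF e fun x => inner ℝ (avgStressN o P.η t.γ u e) (jumpV o v e x))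
  - P.α * (∑ K, intK K fun _ => p K * divg (v K))
  + P.α * (∑ e, intF e fun x => inner ℝ (avgN o p e) (jumpV o v e x))
  - (∑ e, intF e fun x => inner ℝ (jumpV o u e x) (avgStressN o P.η t.γ v e))
  + ∑ e, t.ς₂ / hF e * intF e fun x => inner ℝ (jumpV o u e x) (jumpV o v e x)

open Classical in
/-- The upwind value `c^{n*}` on an interior face, determined by the sign of `u_f^n · nₑ`.  The
normal component of a Raviart-Thomas field is constant on a face, so it is read off at the
barycentre. -/
def upwind {M : Triangulation d Ω} (o : Orientation M) (old : Level M) (e : IFace M) : ℝ :=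
  if 0 ≤ inner ℝ (old.uf (o.fst e) (e.1.centroid ℝ id)) (o.normal e)
  then old.c (o.fst e) else old.c (o.snd e)

/-- The equations determining the level `new` from the previous time level `old`, where the porosity
in the accumulation term and the velocity in the convection term of the mass balance are taken from
`lag`. -/
structure Equations {M : Triangulation d Ω} (o : Orientation M) (P : Physical) (t : Tuning)
    (old lag new : Level M) : Prop where
  /-- The discrete velocity has vanishing normal component on the boundary. -/
  velocity_mem : new.uf ∈ RT0 M
  /-- Stabilized chemical potential. -/
  potential : ∀ K, new.mu K = P.mu (old.c K) +
    t.θ * P.R * P.T * ((new.c K - old.c K) / (old.c K * (1 - P.β * old.c K) ^ 2))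
  /-- Momentum balance. -/
  momentum : ∀ v : P1 M, formA o P t new.us new.p v = 0
  /-- Mass balance. -/
  mass : ∀ q : P0 M,
    (∑ K, intK K fun _ => (lag.phi K * new.c K - old.phi K * old.c K) / t.τ * q K)
    + (∑ e, intF e fun x =>
        upwind o old e * inner ℝ (lag.uf (o.fst e) x) (o.normal e) * jumpQ o q e)
    + (∑ e, t.ς₁ / hF e * intF e fun _ => jumpQ o new.mu e * jumpQ o q e) = 0
  /-- Darcy law. -/
  darcy : ∀ w ∈ RT0 M,
    (∑ K, intK K fun x => (P.mob (old.phi K))⁻¹ * inner ℝ (new.uf K x) (w K x)) =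
    ∑ e, intF e fun x =>
      jumpQ o new.mu e * (upwind o old e * inner ℝ (w (o.fst e) x) (o.normal e))
  /-- Pressure. -/
  pressure : ∀ z : P0 M,
    (∑ K, intK K fun _ => new.p K * z K) =
    ∑ K, intK K fun _ => (old.c K * new.mu K - P.f (old.c K)) * z K
  /-- Porosity. -/
  porosity : ∀ r : P0 M,
    (∑ K, intK K fun _ => (new.phi K - old.phi K) / t.τ * r K) =
    1 / t.N * (∑ K, intK K fun _ => (new.p K - old.p K) / t.τ * r K)
    + P.α * (∑ K, intK K fun _ => (divg (new.us K) - divg (old.us K)) / t.τ * r K)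
    - P.α * ∑ e, intF e fun x =>
        inner ℝ (avgN o r e) ((1 / t.τ) • (jumpV o new.us e x - jumpV o old.us e x))

/-- `new` solves the nonlinear fully discrete system with previous time level `old`. -/
def IsSolution {M : Triangulation d Ω} (o : Orientation M) (P : Physical) (t : Tuning)
    (old new : Level M) : Prop :=
  Equations o P t old new new

/-- `x` is a sequence of iterates of the linear iteration: level `l + 1` solves the linear system in
which the porosity multiplying `c` and the convecting velocity are those of level `l`. -/
def IsIteration {M : Triangulation d Ω} (o : Orientation M) (P : Physical) (t : Tuning)
    (old : Level M) (x : ℕ → Level M) : Prop :=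
  ∀ l, Equations o P t old (x l) (x (l + 1))

/-- Convergence in `L²`, the displacement being taken modulo infinitesimal rigid displacements. -/
structure ConvergesTo {M : Triangulation d Ω} (o : Orientation M) (x : ℕ → Level M)
    (y : Level M) : Prop where
  us : ∃ r : ℕ → P1 M, (∀ l, IsRigid o (r l)) ∧
    Tendsto (fun l => l2SqV ((x l).us - r l - y.us)) atTop (𝓝 0)
  uf : Tendsto (fun l => l2SqV ((x l).uf - y.uf)) atTop (𝓝 0)
  p : Tendsto (fun l => l2SqQ ((x l).p - y.p)) atTop (𝓝 0)
  c : Tendsto (fun l => l2SqQ ((x l).c - y.c)) atTop (𝓝 0)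
  mu : Tendsto (fun l => l2SqQ ((x l).mu - y.mu)) atTop (𝓝 0)
  phi : Tendsto (fun l => l2SqQ ((x l).phi - y.phi)) atTop (𝓝 0)

/-- Two levels agree, up to an infinitesimal rigid displacement in `uₛ`. -/
structure AgreeModRigid {M : Triangulation d Ω} (o : Orientation M) (x y : Level M) : Prop where
  us : IsRigid o (x.us - y.us)
  p : x.p = y.p
  uf : x.uf = y.uf
  c : x.c = y.c
  mu : x.mu = y.mu
  phi : x.phi = y.phi

/-- Bounds on the previous time level: `ϱ₀ ≤ β cⁿ ≤ ϱ`, `φmin ≤ φⁿ ≤ φmax`, `|pⁿ| ≤ pmax`; its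
velocity is in the Raviart-Thomas space and it satisfies the discrete momentum balance. -/
structure IsPreviousLevel {M : Triangulation d Ω} (o : Orientation M) (P : Physical) (t : Tuning)
    (ϱ₀ ϱ φmin φmax pmax : ℝ) (old : Level M) : Prop where
  density : ∀ K, ϱ₀ ≤ P.β * old.c K ∧ P.β * old.c K ≤ ϱ
  porosity : ∀ K, φmin ≤ old.phi K ∧ old.phi K ≤ φmax
  pressure : ∀ K, |old.p K| ≤ pmax
  velocity : old.uf ∈ RT M
  momentum : ∀ v : P1 M, formA o P t old.us old.p v = 0

end PoroGas

end

/-!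
The scheme is an algebraic system for the potential `μ` alone.  Given `μ`, the density and the pressure
are affine functions of it on each element, Darcy's law determines the velocity, the momentum balance
the displacement modulo rigid displacements, and the porosity equation the porosity
(`Constitutive`, `Regime.exists_constitutive`); the mass balance (`MassBalance`) remains.

*Small response of the porosity.*  For a large penalty parameter the elasticity form controls `γ` times
the squared norm of divergence and jumps (`exists_penalty_coercive`), while the discrete divergence that
couples displacement and pressure is bounded by that norm with a constant independent of `γ`.  Hence a
change `δp` of the pressure changes the porosity by at most `(1 / N + C / γ) ‖δp‖`
(`Regime.porosity_le`).  The constants come from one algebraic fact: on a finite-dimensional space, a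
functional that vanishes on the null space of a positive semidefinite form is bounded by the associated
seminorm (`exists_sq_le_form`).  The null spaces are identified by the fact that the volume and surface
measures of the simplices are finite and of full support (`fullOn_simplex`).

*Energy estimate.*  Testing the mass balance with `μ`, the accumulation term gives `‖μ‖²` because the
density is increasing in `μ` and the lagged porosity is bounded below, and the convection term with the
lagged velocity is absorbed by the penalty on the jumps of `μ` when `ς₁` is large (`Regime.energy`).
This bounds `μ`, uniformly in `τ`, along the iteration and keeps the porosity within `Cε` of `φⁿ`
(`Regime.admissible_next`).

*Contraction.*  The same test applied to the difference of two steps shows that a linear step halves the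
quantity `energyDist` (`Regime.stability`).  So the iteration started from `φⁿ` and zero velocity, which
is admissible for all `τ`, converges to a solution; any other admissible iteration converges to the same
solution; and two solutions coincide, since each is a step with itself as the lagged level.  The
stability estimate needs the lower bound of only one of the two lagged porosities, and the upper bound
of the density only at the other level, which is what both alternatives of the uniqueness assertion
provide.
-/

noncomputable section

namespace PoroGas

/-! ### Positive semidefinite forms on finite-dimensional spaces -/

section Algebra

variable {V : Type*} [AddCommGroup V] [Module ℝ V]

/-- Riesz representation for a degenerate form: a functional that vanishes on the isotropic vectors
of a symmetric form, in particular on its kernel, is represented by the form. -/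
theorem exists_form_eq [FiniteDimensional ℝ V] (B : LinearMap.BilinForm ℝ V)
    (hs : ∀ x y, B x y = B y x) (l : V →ₗ[ℝ] ℝ)
    (hl : ∀ x, B x x = 0 → l x = 0) : ∃ u, ∀ v, B u v = l v := by
  have hmem : l ∈ LinearMap.range B := by
    have hker : l ∈ (LinearMap.ker B).dualAnnihilator := by
      rw [Submodule.mem_dualAnnihilator]
      intro w hw
      exact hl w (by rw [LinearMap.mem_ker.1 hw]; rfl)
    have hflip : B.dualMap ∘ₗ (Module.evalEquiv ℝ V).toLinearMap = B := by
      ext x y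
      simp [hs x y]
    rw [← LinearMap.range_dualMap_eq_dualAnnihilator_ker] at hker
    obtain ⟨g, hg⟩ := hker
    obtain ⟨x, rfl⟩ := (Module.evalEquiv ℝ V).surjective g
    exact ⟨x, (LinearMap.congr_fun hflip x).symm.trans hg⟩
  obtain ⟨u, hu⟩ := hmem
  exact ⟨u, fun v => by rw [hu]⟩

theorem form_sq_le (B : LinearMap.BilinForm ℝ V) (hs : ∀ x y, B x y = B y x)
    (hp : ∀ x, 0 ≤ B x x) (x y : V) : B x y ^ 2 ≤ B x x * B y y := by
  have := B.apply_mul_apply_le_of_forall_zero_le hp x y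
  rw [hs y x] at this
  nlinarith

/-- A functional that vanishes on the null space of a positive semidefinite form is bounded by the
associated seminorm. -/
theorem exists_sq_le_form [FiniteDimensional ℝ V] (B : LinearMap.BilinForm ℝ V)
    (hs : ∀ x y, B x y = B y x) (hp : ∀ x, 0 ≤ B x x) (l : V →ₗ[ℝ] ℝ)
    (hl : ∀ x, B x x = 0 → l x = 0) : ∃ C, 0 ≤ C ∧ ∀ v, l v ^ 2 ≤ C * B v v := by
  obtain ⟨u, hu⟩ := exists_form_eq B hs l hl
  exact ⟨B u u, hp u, fun v => by rw [← hu]; exact form_sq_le B hs hp u v⟩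

theorem exists_sq_le_form_family [FiniteDimensional ℝ V] {ι : Type*} [Fintype ι]
    (B : LinearMap.BilinForm ℝ V)
    (hs : ∀ x y, B x y = B y x) (hp : ∀ x, 0 ≤ B x x) (l : ι → V →ₗ[ℝ] ℝ)
    (hl : ∀ i x, B x x = 0 → l i x = 0) : ∃ C, 0 ≤ C ∧ ∀ v, ∑ i, l i v ^ 2 ≤ C * B v v := by
  choose C hC h using fun i => exists_sq_le_form B hs hp (l i) (hl i)
  refine ⟨∑ i, C i, Finset.sum_nonneg fun i _ => hC i, fun v => ?_⟩
  rw [Finset.sum_mul]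
  exact Finset.sum_le_sum fun i _ => h i v

end Algebra

/-! ### Surface measure on simplices -/

/-- `S` is compact of finite `μ`-measure, and every point of `S` lies in the support of `μ`
restricted to `S`. -/
structure FullOn {X : Type*} [TopologicalSpace X] [MeasurableSpace X] (μ : Measure X)
    (S : Set X) : Prop where
  compact : IsCompact S
  lt_top : μ S < ⊤
  pos : ∀ U, IsOpen U → (U ∩ S).Nonempty → 0 < μ (U ∩ S)

theorem FullOn.integrableOn {d : ℕ} {μ : Measure (E d)} {S : Set (E d)} (h : FullOn μ S)
    {F : Type*} [NormedAddCommGroup F] {g : E d → F} (hg : Continuous g) : IntegrableOn g S μ := by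
  obtain ⟨C, hC⟩ := h.compact.exists_bound_of_continuousOn hg.continuousOn
  have : IsFiniteMeasure (μ.restrict S) := ⟨by simpa using h.lt_top⟩
  refine Integrable.of_bound (C := C) ?_ ?_
  · exact hg.continuousOn.aestronglyMeasurable_of_isCompact h.compact h.compact.measurableSet
  · exact (ae_restrict_iff' h.compact.measurableSet).2 (ae_of_all _ hC)

theorem FullOn.eq_zero {d : ℕ} {μ : Measure (E d)} {S : Set (E d)} (h : FullOn μ S)
    {g : E d → ℝ} (hg : Continuous g) (hpos : ∀ x, 0 ≤ g x) (h0 : ∫ x in S, g x ∂μ = 0) :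
    ∀ x ∈ S, g x = 0 := by
  rw [integral_eq_zero_iff_of_nonneg (fun x => hpos x) (h.integrableOn hg)] at h0
  by_contra! hx
  obtain ⟨x, hxS, hx⟩ := hx
  have hU : IsOpen {y | g y ≠ 0} := isOpen_ne_fun hg continuous_const
  have := h.pos _ hU ⟨x, hx, hxS⟩
  have h1 : μ.restrict S {y | g y ≠ 0} = 0 := h0
  rw [Measure.restrict_apply hU.measurableSet] at h1
  exact this.ne' h1

/-- A `k`-simplex in `ℝᵈ` is the image of a full-dimensional simplex of `ℝᵏ` under an affine
isometry, so that its `k`-dimensional measure is positive, finite, and has full support. -/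
theorem fullOn_simplex {d k : ℕ} {s : Finset (E d)}
    (hs : AffineIndependent ℝ ((↑) : s → E d)) (hk : s.card = k + 1) :
    FullOn (Measure.euclideanHausdorffMeasure k) (convexHull ℝ (s : Set (E d))) := by
  have hne : s.Nonempty := Finset.card_pos.1 (by omega)
  obtain ⟨p, hp⟩ := hne
  set D := (affineSpan ℝ (s : Set (E d))).direction with hD
  have hfin : Module.finrank ℝ D = k := by
    have h1 := hs.finrank_vectorSpan (n := k) (by simpa using hk)
    have h2 : Set.range ((↑) : s → E d) = (s : Set (E d)) := Subtype.range_coe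
    rw [hD, direction_affineSpan, ← h2]
    exact h1
  let L : E k ≃ₗᵢ[ℝ] D := ((stdOrthonormalBasis ℝ D).reindex (finCongr hfin)).repr.symm
  let f : E k →ᵃⁱ[ℝ] E d :=
    { toAffineMap := (D.subtype ∘ₗ L.toLinearEquiv.toLinearMap).toAffineMap + AffineMap.const ℝ _ p
      norm_map := fun x => by
        have h : ‖(L x : E d)‖ = ‖x‖ := L.norm_map x
        simpa using h }
  have hf : ∀ x, f x = (L x : E d) + p := fun x => rfl
  have hiso : Isometry f := f.isometry
  have hpA : p ∈ affineSpan ℝ (s : Set (E d)) := subset_affineSpan ℝ _ hp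
  have hrange : ∀ y ∈ affineSpan ℝ (s : Set (E d)), y ∈ Set.range f := by
    intro y hy
    have hv : y -ᵥ p ∈ D := AffineSubspace.vsub_mem_direction hy hpA
    refine ⟨L.symm ⟨y -ᵥ p, hv⟩, ?_⟩
    rw [hf]
    simp
  let t : Set (E k) := f ⁻¹' (s : Set (E d))
  have himg : f '' t = (s : Set (E d)) :=
    Set.image_preimage_eq_of_subset fun y hy => hrange y (subset_affineSpan ℝ _ hy)
  have hhull : convexHull ℝ (s : Set (E d)) = f '' convexHull ℝ t := by
    rw [← himg]
    exact (f.toAffineMap.image_convexHull t).symm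
  have hspan : affineSpan ℝ t = ⊤ := by
    rw [eq_top_iff]
    intro x _
    have h1 : f x ∈ affineSpan ℝ (s : Set (E d)) := by
      rw [hf, add_comm]
      have := AffineSubspace.vadd_mem_of_mem_direction (L x).2 hpA
      simpa [add_comm] using this
    rw [← himg] at h1
    have h2 : affineSpan ℝ (f '' t) = (affineSpan ℝ t).map f.toAffineMap :=
      (AffineSubspace.map_span f.toAffineMap t).symm
    rw [h2] at h1
    obtain ⟨y, hy, hyx⟩ := h1
    have : y = x := f.injective hyx
    exact this ▸ hy
  have hint : (interior (convexHull ℝ t)).Nonempty :=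
    interior_convexHull_nonempty_iff_affineSpan_eq_top.2 hspan
  have hcl : closure (interior (convexHull ℝ t)) = closure (convexHull ℝ t) :=
    (convex_convexHull ℝ t).closure_interior_eq_closure_of_nonempty_interior hint
  have htfin : t.Finite := s.finite_toSet.preimage f.injective.injOn
  have htc : IsCompact (convexHull ℝ t) := htfin.isCompact_convexHull (𝕜 := ℝ)
  have hμ : ∀ A : Set (E k),
      (Measure.euclideanHausdorffMeasure k : Measure (E d)) (f '' A) = volume A := fun A => by
    rw [hiso.euclideanHausdorffMeasure_image, EuclideanSpace.euclideanHausdorffMeasure_eq_volume]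
  refine ⟨s.finite_toSet.isCompact_convexHull (𝕜 := ℝ), ?_, ?_⟩
  · rw [hhull, hμ]
    exact htc.measure_lt_top
  · rintro U hU ⟨y, hyU, hyS⟩
    rw [hhull] at hyS ⊢
    obtain ⟨x, hx, rfl⟩ := hyS
    have h1 : U ∩ f '' convexHull ℝ t = f '' (f ⁻¹' U ∩ convexHull ℝ t) := by
      rw [Set.image_preimage_inter]
    rw [h1, hμ]
    have hV : IsOpen (f ⁻¹' U) := hU.preimage hiso.continuous
    have hx' : x ∈ closure (interior (convexHull ℝ t)) := hcl ▸ subset_closure hx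
    obtain ⟨z, hz⟩ := mem_closure_iff.1 hx' _ hV hyU
    refine ((hV.inter isOpen_interior).measure_pos volume ⟨z, hz⟩).trans_le (measure_mono ?_)
    exact Set.inter_subset_inter_right _ interior_subset

/-! ### Cells, faces and integrals of polynomial fields -/

section Mesh

variable {d : ℕ} {Ω : Set (E d)} {M : Triangulation d Ω}

theorem Elem.fullOn (K : Elem M) : FullOn volume K.cell := by
  have := fullOn_simplex (M.complex.indep K.2.1) K.2.2
  rwa [EuclideanSpace.euclideanHausdorffMeasure_eq_volume] at this

theorem IFace.fullOn [NeZero d] (e : IFace M) :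
    FullOn (Measure.euclideanHausdorffMeasure (d - 1)) e.cell :=
  fullOn_simplex (M.complex.indep e.2.1) (by
    have h1 := e.2.2.1
    have h2 := NeZero.ne d
    omega)

theorem FullOn.toReal_pos {μ : Measure (E d)} {S : Set (E d)} (h : FullOn μ S)
    (hS : S.Nonempty) : 0 < (μ S).toReal := by
  have := h.pos Set.univ isOpen_univ (by simpa using hS)
  rw [Set.univ_inter] at this
  exact ENNReal.toReal_pos this.ne' h.lt_top.ne

/-- The volume `|K|` of an element. -/
def vol (K : Elem M) : ℝ := (volume K.cell).toReal

theorem Elem.cell_nonempty (K : Elem M) : K.cell.Nonempty :=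
  (convexHull_nonempty_iff (𝕜 := ℝ)).2 (Finset.coe_nonempty.2
    (Finset.card_pos.1 (by have := K.2.2; omega)))

theorem IFace.cell_nonempty [NeZero d] (e : IFace M) : e.cell.Nonempty :=
  (convexHull_nonempty_iff (𝕜 := ℝ)).2 (Finset.coe_nonempty.2
    (Finset.card_pos.1 (by have := e.2.2.1; have h2 := NeZero.ne d; omega)))

theorem vol_pos (K : Elem M) : 0 < vol K := K.fullOn.toReal_pos K.cell_nonempty

theorem hF_pos [NeZero d] (e : IFace M) : 0 < hF e := e.fullOn.toReal_pos e.cell_nonempty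

theorem intK_const (K : Elem M) (r : ℝ) : intK K (fun _ => r) = vol K * r := by
  simp [intK, vol, Measure.real]

theorem intF_const (e : IFace M) (r : ℝ) : intF e (fun _ => r) = hF e * r := by
  simp [intF, hF, Measure.real]

theorem intF_mul_left (e : IFace M) (r : ℝ) (g : E d → ℝ) :
    intF e (fun x => r * g x) = r * intF e g := integral_const_mul _ _

theorem l2SqQ_eq (q : P0 M) : l2SqQ q = ∑ K, vol K * q K ^ 2 := by
  simp [l2SqQ, intK_const]

theorem continuous_apply (v : P1 M) (K : Elem M) : Continuous (v K) :=
  (v K).continuous_of_finiteDimensional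

theorem continuous_jumpV (o : Orientation M) (v : P1 M) (e : IFace M) :
    Continuous (jumpV o v e) :=
  (continuous_apply v _).sub (continuous_apply v _)

theorem jumpV_add (o : Orientation M) (u v : P1 M) (e : IFace M) (x : E d) :
    jumpV o (u + v) e x = jumpV o u e x + jumpV o v e x := by
  simp only [jumpV, Pi.add_apply, AffineMap.coe_add]
  abel

theorem jumpV_smul (o : Orientation M) (r : ℝ) (v : P1 M) (e : IFace M) (x : E d) :
    jumpV o (r • v) e x = r • jumpV o v e x := by
  simp only [jumpV, Pi.smul_apply, AffineMap.coe_smul, smul_sub]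

/-- The `L²(K)` inner product of piecewise affine fields. -/
def cellForm (K : Elem M) : LinearMap.BilinForm ℝ (P1 M) :=
  LinearMap.mk₂ ℝ (fun u v => intK K fun x => inner ℝ (u K x) (v K x))
    (fun u u' v => by
      simp only [intK, Pi.add_apply, AffineMap.coe_add, inner_add_left]
      exact integral_add
        (K.fullOn.integrableOn ((continuous_apply u K).inner (continuous_apply v K)))
        (K.fullOn.integrableOn ((continuous_apply u' K).inner (continuous_apply v K))))
    (fun r u v => by
      simp only [intK, Pi.smul_apply, AffineMap.coe_smul, real_inner_smul_left]
      exact integral_const_mul _ _)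
    (fun u v v' => by
      simp only [intK, Pi.add_apply, AffineMap.coe_add, inner_add_right]
      exact integral_add
        (K.fullOn.integrableOn ((continuous_apply u K).inner (continuous_apply v K)))
        (K.fullOn.integrableOn ((continuous_apply u K).inner (continuous_apply v' K))))
    (fun r u v => by
      simp only [intK, Pi.smul_apply, AffineMap.coe_smul, real_inner_smul_right]
      exact integral_const_mul _ _)

theorem cellForm_apply (K : Elem M) (u v : P1 M) :
    cellForm K u v = intK K fun x => inner ℝ (u K x) (v K x) := rfl

theorem cellForm_comm (K : Elem M) (u v : P1 M) : cellForm K u v = cellForm K v u := by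
  simp only [cellForm_apply, real_inner_comm]

theorem cellForm_self (K : Elem M) (u : P1 M) :
    cellForm K u u = intK K fun x => ‖u K x‖ ^ 2 := by
  simp only [cellForm_apply, real_inner_self_eq_norm_sq]

theorem cellForm_nonneg (K : Elem M) (u : P1 M) : 0 ≤ cellForm K u u := by
  rw [cellForm_self]
  exact integral_nonneg fun x => sq_nonneg _

/-- An affine field whose `L²(K)` norm vanishes is zero, the simplex being nondegenerate. -/
theorem eq_zero_of_cellForm (K : Elem M) (u : P1 M) (h : cellForm K u u = 0) : u K = 0 := by
  rw [cellForm_self] at h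
  have h0 := K.fullOn.eq_zero (g := fun x => ‖u K x‖ ^ 2)
    ((continuous_apply u K).norm.pow 2) (fun x => sq_nonneg _) h
  have hspan : affineSpan ℝ (K.1 : Set (E d)) = ⊤ := by
    have h2 : Set.range ((↑) : K.1 → E d) = (K.1 : Set (E d)) := Subtype.range_coe
    rw [← h2, (M.complex.indep K.2.1).affineSpan_eq_top_iff_card_eq_finrank_add_one]
    simpa using K.2.2
  have hon : Set.EqOn (u K) (0 : E d →ᵃ[ℝ] E d) (K.1 : Set (E d)) := fun x hx => by
    have := h0 x (subset_convexHull ℝ _ hx)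
    simpa using this
  exact AffineMap.ext_on hspan hon

/-- The `L²(Ω)` inner product of piecewise affine fields. -/
def l2Form : LinearMap.BilinForm ℝ (P1 M) := ∑ K, cellForm K

theorem l2Form_apply (u v : P1 M) : l2Form u v = ∑ K, cellForm K u v := by
  simp [l2Form, LinearMap.sum_apply]

theorem l2SqV_eq (v : P1 M) : l2SqV v = l2Form v v := by
  rw [l2Form_apply]
  simp only [l2SqV, cellForm_self]

theorem l2Form_comm (u v : P1 M) : l2Form u v = l2Form v u := by
  simp only [l2Form_apply, cellForm_comm _ u v]

theorem l2Form_nonneg (u : P1 M) : 0 ≤ l2Form u u := by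
  rw [l2Form_apply]
  exact Finset.sum_nonneg fun K _ => cellForm_nonneg K u

theorem eq_zero_of_l2Form (u : P1 M) (h : l2Form u u = 0) : u = 0 := by
  rw [l2Form_apply, Finset.sum_eq_zero_iff_of_nonneg fun K _ => cellForm_nonneg K u] at h
  funext K
  exact eq_zero_of_cellForm K u (h K (Finset.mem_univ K))

variable [NeZero d]

/-- The `L²(e)` product of the jumps across an interior face. -/
def jumpForm (o : Orientation M) (e : IFace M) : LinearMap.BilinForm ℝ (P1 M) :=
  LinearMap.mk₂ ℝ (fun u v => intF e fun x => inner ℝ (jumpV o u e x) (jumpV o v e x))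
    (fun u u' v => by
      simp only [intF, jumpV_add, inner_add_left]
      exact integral_add
        (e.fullOn.integrableOn ((continuous_jumpV o u e).inner (continuous_jumpV o v e)))
        (e.fullOn.integrableOn ((continuous_jumpV o u' e).inner (continuous_jumpV o v e))))
    (fun r u v => by
      simp only [intF, jumpV_smul, real_inner_smul_left]
      exact integral_const_mul _ _)
    (fun u v v' => by
      simp only [intF, jumpV_add, inner_add_right]
      exact integral_add
        (e.fullOn.integrableOn ((continuous_jumpV o u e).inner (continuous_jumpV o v e)))
        (e.fullOn.integrableOn ((continuous_jumpV o u e).inner (continuous_jumpV o v' e))))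
    (fun r u v => by
      simp only [intF, jumpV_smul, real_inner_smul_right]
      exact integral_const_mul _ _)

theorem jumpForm_apply (o : Orientation M) (e : IFace M) (u v : P1 M) :
    jumpForm o e u v = intF e fun x => inner ℝ (jumpV o u e x) (jumpV o v e x) := rfl

theorem jumpForm_comm (o : Orientation M) (e : IFace M) (u v : P1 M) :
    jumpForm o e u v = jumpForm o e v u := by
  simp only [jumpForm_apply, real_inner_comm]

theorem jumpForm_self (o : Orientation M) (e : IFace M) (u : P1 M) :
    jumpForm o e u u = intF e fun x => ‖jumpV o u e x‖ ^ 2 := by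
  simp only [jumpForm_apply, real_inner_self_eq_norm_sq]

theorem jumpForm_nonneg (o : Orientation M) (e : IFace M) (u : P1 M) : 0 ≤ jumpForm o e u u := by
  rw [jumpForm_self]
  exact integral_nonneg fun x => sq_nonneg _

theorem jumpV_eq_zero (o : Orientation M) (e : IFace M) (u : P1 M) (h : jumpForm o e u u = 0) :
    ∀ x ∈ e.cell, jumpV o u e x = 0 := by
  rw [jumpForm_self] at h
  intro x hx
  have h0 := e.fullOn.eq_zero (g := fun x => ‖jumpV o u e x‖ ^ 2)
    ((continuous_jumpV o u e).norm.pow 2) (fun x => sq_nonneg _) h x hx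
  simpa using h0

/-- The integral of the jump across an interior face. -/
def jumpMean (o : Orientation M) (e : IFace M) : P1 M →ₗ[ℝ] E d where
  toFun v := ∫ x in e.cell, jumpV o v e x ∂(Measure.euclideanHausdorffMeasure (d - 1))
  map_add' u v := by
    simp only [jumpV_add]
    exact integral_add (e.fullOn.integrableOn (continuous_jumpV o u e))
      (e.fullOn.integrableOn (continuous_jumpV o v e))
  map_smul' r u := by
    simp only [jumpV_smul]
    exact integral_smul _ _

theorem intF_inner_jumpV (o : Orientation M) (e : IFace M) (w : E d) (v : P1 M) :
    intF e (fun x => inner ℝ w (jumpV o v e x)) = inner ℝ w (jumpMean o e v) :=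
  integral_inner (e.fullOn.integrableOn (continuous_jumpV o v e)) w

theorem intF_jumpV_inner (o : Orientation M) (e : IFace M) (w : E d) (v : P1 M) :
    intF e (fun x => inner ℝ (jumpV o v e x) w) = inner ℝ w (jumpMean o e v) := by
  rw [← intF_inner_jumpV]
  simp only [real_inner_comm]

theorem jumpMean_eq_zero (o : Orientation M) (e : IFace M) (u : P1 M)
    (h : ∀ x ∈ e.cell, jumpV o u e x = 0) : jumpMean o e u = 0 :=
  setIntegral_eq_zero_of_forall_eq_zero h

/-- The flux of the trace from the first neighbour through an interior face. -/
def flux (o : Orientation M) (e : IFace M) : P1 M →ₗ[ℝ] ℝ where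
  toFun u := intF e fun x => inner ℝ (u (o.fst e) x) (o.normal e)
  map_add' u v := by
    simp only [intF, Pi.add_apply, AffineMap.coe_add, inner_add_left]
    exact integral_add
      (e.fullOn.integrableOn ((continuous_apply u _).inner continuous_const))
      (e.fullOn.integrableOn ((continuous_apply v _).inner continuous_const))
  map_smul' r u := by
    simp only [intF, Pi.smul_apply, AffineMap.coe_smul, real_inner_smul_left]
    exact integral_const_mul _ _

theorem flux_apply (o : Orientation M) (e : IFace M) (u : P1 M) :
    flux o e u = intF e fun x => inner ℝ (u (o.fst e) x) (o.normal e) := rfl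

end Mesh

/-! ### Strain and stress -/

section Strain

variable {d : ℕ}

theorem strain_apply (v : E d →ᵃ[ℝ] E d) (i j : Fin d) :
    strain v i j = 1 / 2 * (v.linear (EuclideanSpace.single j 1) i +
      v.linear (EuclideanSpace.single i 1) j) := by
  simp [strain, grad]

theorem strain_add (u v : E d →ᵃ[ℝ] E d) : strain (u + v) = strain u + strain v := by
  ext i j
  simp only [strain_apply, Matrix.add_apply, AffineMap.add_linear, LinearMap.add_apply,
    PiLp.add_apply]
  ring

theorem strain_smul (r : ℝ) (v : E d →ᵃ[ℝ] E d) : strain (r • v) = r • strain v := by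
  ext i j
  simp only [strain_apply, Matrix.smul_apply, AffineMap.smul_linear, LinearMap.smul_apply,
    PiLp.smul_apply, smul_eq_mul]
  ring

theorem trace_strain (v : E d →ᵃ[ℝ] E d) : (strain v).trace = divg v := by
  simp only [strain, divg, Matrix.trace_smul, Matrix.trace_add, Matrix.trace_transpose,
    smul_eq_mul]
  ring

theorem divg_add (u v : E d →ᵃ[ℝ] E d) : divg (u + v) = divg u + divg v := by
  simp only [← trace_strain, strain_add, Matrix.trace_add]

theorem divg_smul (r : ℝ) (v : E d →ᵃ[ℝ] E d) : divg (r • v) = r * divg v := by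
  simp only [← trace_strain, strain_smul, Matrix.trace_smul, smul_eq_mul]

theorem stress_add (η γ : ℝ) (u v : E d →ᵃ[ℝ] E d) :
    stress η γ (u + v) = stress η γ u + stress η γ v := by
  simp only [stress, strain_add, divg_add, smul_add, mul_add, add_smul]
  abel

theorem stress_smul (η γ r : ℝ) (v : E d →ᵃ[ℝ] E d) :
    stress η γ (r • v) = r • stress η γ v := by
  simp only [stress, strain_smul, divg_smul, smul_add, smul_smul]
  congr 2 <;> ring

theorem frob_stress_strain (η γ : ℝ) (u v : E d →ᵃ[ℝ] E d) :
    frob (stress η γ u) (strain v) =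
      2 * η * frob (strain u) (strain v) + γ * (divg u * divg v) := by
  have h : frob (1 : Matrix (Fin d) (Fin d) ℝ) (strain v) = divg v := by
    simp [frob, ← trace_strain, Matrix.trace, Matrix.one_apply]
  have h2 : frob (stress η γ u) (strain v) = 2 * η * frob (strain u) (strain v)
      + γ * divg u * frob (1 : Matrix (Fin d) (Fin d) ℝ) (strain v) := by
    simp only [frob, stress, Matrix.add_apply, Matrix.smul_apply, smul_eq_mul, Finset.mul_sum,
      ← Finset.sum_add_distrib]
    refine Finset.sum_congr rfl fun i _ => Finset.sum_congr rfl fun j _ => by ring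
  rw [h2, h]
  ring

theorem frob_comm (A B : Matrix (Fin d) (Fin d) ℝ) : frob A B = frob B A := by
  simp only [frob, mul_comm]

theorem frob_self_nonneg (A : Matrix (Fin d) (Fin d) ℝ) : 0 ≤ frob A A :=
  Finset.sum_nonneg fun _ _ => Finset.sum_nonneg fun _ _ => mul_self_nonneg _

theorem eq_zero_of_frob (A : Matrix (Fin d) (Fin d) ℝ) (h : frob A A = 0) : A = 0 := by
  have h1 := (Finset.sum_eq_zero_iff_of_nonneg
    fun i _ => Finset.sum_nonneg fun j _ => mul_self_nonneg (A i j)).1 h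
  ext i j
  have h2 := (Finset.sum_eq_zero_iff_of_nonneg
    fun j _ => mul_self_nonneg (A i j)).1 (h1 i (Finset.mem_univ i))
  simpa using h2 j (Finset.mem_univ j)

theorem frob_add_left (A A' B : Matrix (Fin d) (Fin d) ℝ) :
    frob (A + A') B = frob A B + frob A' B := by
  simp only [frob, Matrix.add_apply, add_mul, Finset.sum_add_distrib]

theorem frob_smul_left (r : ℝ) (A B : Matrix (Fin d) (Fin d) ℝ) :
    frob (r • A) B = r * frob A B := by
  simp only [frob, Matrix.smul_apply, smul_eq_mul, Finset.mul_sum, mul_assoc]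

theorem act_add (A B : Matrix (Fin d) (Fin d) ℝ) (n : E d) : act (A + B) n = act A n + act B n := by
  simp only [act, Matrix.add_mulVec, WithLp.toLp_add]

theorem act_smul (r : ℝ) (A : Matrix (Fin d) (Fin d) ℝ) (n : E d) :
    act (r • A) n = r • act A n := by
  simp only [act, Matrix.smul_mulVec, WithLp.toLp_smul]

theorem stress_eq_zero (η γ : ℝ) (v : E d →ᵃ[ℝ] E d) (h : strain v = 0) : stress η γ v = 0 := by
  simp [stress, ← trace_strain, h]

end Strain

/-! ### The elasticity form -/

section Elasticity

variable {d : ℕ} {Ω : Set (E d)} {M : Triangulation d Ω}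

theorem exists_vol_lower (M : Triangulation d Ω) : ∃ m > 0, ∀ K : Elem M, m ≤ vol K := by
  rcases isEmpty_or_nonempty (Elem M) with h | h
  · exact ⟨1, one_pos, fun K => h.elim K⟩
  · obtain ⟨K₀, hK₀⟩ := Finite.exists_min (vol : Elem M → ℝ)
    exact ⟨vol K₀, vol_pos K₀, hK₀⟩

/-- The `L²(Ω)` inner product of piecewise constant functions. -/
def qForm : LinearMap.BilinForm ℝ (P0 M) :=
  LinearMap.mk₂ ℝ (fun p q => ∑ K, vol K * (p K * q K))
    (fun p p' q => by
      rw [← Finset.sum_add_distrib]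
      exact Finset.sum_congr rfl fun K _ => by simp only [Pi.add_apply]; ring)
    (fun r p q => by
      rw [smul_eq_mul, Finset.mul_sum]
      exact Finset.sum_congr rfl fun K _ => by simp only [Pi.smul_apply, smul_eq_mul]; ring)
    (fun p q q' => by
      rw [← Finset.sum_add_distrib]
      exact Finset.sum_congr rfl fun K _ => by simp only [Pi.add_apply]; ring)
    (fun r p q => by
      rw [smul_eq_mul, Finset.mul_sum]
      exact Finset.sum_congr rfl fun K _ => by simp only [Pi.smul_apply, smul_eq_mul]; ring)

theorem qForm_apply (p q : P0 M) : qForm p q = ∑ K, vol K * (p K * q K) := rfl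

theorem qForm_comm (p q : P0 M) : qForm p q = qForm q p := by
  simp only [qForm_apply, mul_comm (p _) (q _)]

theorem l2SqQ_eq_qForm (p : P0 M) : l2SqQ p = qForm p p := by
  simp only [l2SqQ_eq, qForm_apply, sq]

theorem l2SqQ_nonneg (p : P0 M) : 0 ≤ l2SqQ p := by
  rw [l2SqQ_eq]
  exact Finset.sum_nonneg fun K _ => mul_nonneg (vol_pos K).le (sq_nonneg _)

theorem qForm_sq_le (p q : P0 M) : qForm p q ^ 2 ≤ l2SqQ p * l2SqQ q := by
  rw [l2SqQ_eq_qForm, l2SqQ_eq_qForm]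
  exact form_sq_le _ qForm_comm (fun x => by rw [← l2SqQ_eq_qForm]; exact l2SqQ_nonneg x) p q

theorem mul_sq_le_l2SqQ (p : P0 M) (K : Elem M) : vol K * p K ^ 2 ≤ l2SqQ p := by
  rw [l2SqQ_eq]
  exact Finset.single_le_sum (f := fun K => vol K * p K ^ 2)
    (fun K _ => mul_nonneg (vol_pos K).le (sq_nonneg _)) (Finset.mem_univ K)

theorem eq_zero_of_l2SqQ (p : P0 M) (h : l2SqQ p ≤ 0) : p = 0 := by
  funext K
  have h1 := mul_sq_le_l2SqQ p K
  have h2 : p K ^ 2 ≤ 0 := by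
    by_contra! hc
    have := mul_pos (vol_pos K) hc
    linarith
  simpa using le_antisymm h2 (sq_nonneg _)

/-- The strain form `(ε(u), ε(v))`. -/
def strainForm : LinearMap.BilinForm ℝ (P1 M) :=
  LinearMap.mk₂ ℝ (fun u v => ∑ K, vol K * frob (strain (u K)) (strain (v K)))
    (fun u u' v => by
      simp only [Pi.add_apply, strain_add, frob_add_left, mul_add, Finset.sum_add_distrib])
    (fun r u v => by
      simp only [Pi.smul_apply, strain_smul, frob_smul_left, smul_eq_mul, Finset.mul_sum]
      exact Finset.sum_congr rfl fun K _ => by ring)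
    (fun u v v' => by
      simp only [Pi.add_apply, strain_add, frob_comm (strain (u _)), frob_add_left, mul_add,
        Finset.sum_add_distrib])
    (fun r u v => by
      simp only [Pi.smul_apply, strain_smul, frob_comm (strain (u _)), frob_smul_left, smul_eq_mul,
        Finset.mul_sum]
      exact Finset.sum_congr rfl fun K _ => by ring)

theorem strainForm_apply (u v : P1 M) :
    strainForm u v = ∑ K, vol K * frob (strain (u K)) (strain (v K)) := rfl

theorem strainForm_comm (u v : P1 M) : strainForm u v = strainForm v u := by
  simp only [strainForm_apply, frob_comm (strain (u _))]

theorem strainForm_nonneg (u : P1 M) : 0 ≤ strainForm u u :=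
  Finset.sum_nonneg fun K _ => mul_nonneg (vol_pos K).le (frob_self_nonneg _)

theorem strain_eq_zero (u : P1 M) (h : strainForm u u = 0) (K : Elem M) : strain (u K) = 0 := by
  rw [strainForm_apply, Finset.sum_eq_zero_iff_of_nonneg
    fun K _ => mul_nonneg (vol_pos K).le (frob_self_nonneg _)] at h
  have := h K (Finset.mem_univ K)
  exact eq_zero_of_frob _ ((mul_eq_zero.1 this).resolve_left (vol_pos K).ne')

/-- The divergence form `(∇·u, ∇·v)`. -/
def divForm : LinearMap.BilinForm ℝ (P1 M) :=
  LinearMap.mk₂ ℝ (fun u v => ∑ K, vol K * (divg (u K) * divg (v K)))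
    (fun u u' v => by
      simp only [Pi.add_apply, divg_add, add_mul, mul_add, Finset.sum_add_distrib])
    (fun r u v => by
      simp only [Pi.smul_apply, divg_smul, smul_eq_mul, Finset.mul_sum]
      exact Finset.sum_congr rfl fun K _ => by ring)
    (fun u v v' => by
      simp only [Pi.add_apply, divg_add, mul_add, Finset.sum_add_distrib])
    (fun r u v => by
      simp only [Pi.smul_apply, divg_smul, smul_eq_mul, Finset.mul_sum]
      exact Finset.sum_congr rfl fun K _ => by ring)

theorem divForm_apply (u v : P1 M) :
    divForm u v = ∑ K, vol K * (divg (u K) * divg (v K)) := rfl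

theorem divForm_comm (u v : P1 M) : divForm u v = divForm v u := by
  simp only [divForm_apply, mul_comm (divg (u _))]

theorem divForm_nonneg (u : P1 M) : 0 ≤ divForm u u :=
  Finset.sum_nonneg fun K _ => mul_nonneg (vol_pos K).le (mul_self_nonneg _)

theorem divg_eq_zero (u : P1 M) (h : divForm u u = 0) (K : Elem M) : divg (u K) = 0 := by
  rw [divForm_apply, Finset.sum_eq_zero_iff_of_nonneg
    fun K _ => mul_nonneg (vol_pos K).le (mul_self_nonneg _)] at h
  have := h K (Finset.mem_univ K)
  simpa using (mul_eq_zero.1 this).resolve_left (vol_pos K).ne'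

theorem avgStressN_add (o : Orientation M) (η γ : ℝ) (u v : P1 M) (e : IFace M) :
    avgStressN o η γ (u + v) e = avgStressN o η γ u e + avgStressN o η γ v e := by
  simp only [avgStressN, Pi.add_apply, stress_add, act_add, smul_add]
  abel

theorem avgStressN_smul (o : Orientation M) (η γ r : ℝ) (v : P1 M) (e : IFace M) :
    avgStressN o η γ (r • v) e = r • avgStressN o η γ v e := by
  simp only [avgStressN, Pi.smul_apply, stress_smul, act_smul, smul_add]
  simp only [smul_comm r]

theorem avgStressN_eq_zero (o : Orientation M) (η γ : ℝ) (v : P1 M) (e : IFace M)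
    (h : ∀ K, strain (v K) = 0) : avgStressN o η γ v e = 0 := by
  simp [avgStressN, stress_eq_zero _ _ _ (h _), act]

theorem avgN_add (o : Orientation M) (p q : P0 M) (e : IFace M) :
    avgN o (p + q) e = avgN o p e + avgN o q e := by
  simp only [avgN, Pi.add_apply, add_smul, smul_add]
  abel

theorem avgN_smul (o : Orientation M) (r : ℝ) (q : P0 M) (e : IFace M) :
    avgN o (r • q) e = r • avgN o q e := by
  simp only [avgN, Pi.smul_apply, smul_add, smul_smul, smul_eq_mul]
  congr 2 <;> ring

variable [NeZero d]

/-- The penalty `∑ₑ hₑ⁻¹ ⟨[u], [v]⟩ₑ`. -/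
def penForm (o : Orientation M) : LinearMap.BilinForm ℝ (P1 M) := ∑ e, (1 / hF e) • jumpForm o e

theorem penForm_apply (o : Orientation M) (u v : P1 M) :
    penForm o u v = ∑ e, 1 / hF e * jumpForm o e u v := by
  simp [penForm, LinearMap.sum_apply]

theorem penForm_comm (o : Orientation M) (u v : P1 M) : penForm o u v = penForm o v u := by
  simp only [penForm_apply, jumpForm_comm o _ u v]

theorem penForm_nonneg (o : Orientation M) (u : P1 M) : 0 ≤ penForm o u u := by
  rw [penForm_apply]
  exact Finset.sum_nonneg fun e _ =>
    mul_nonneg (one_div_pos.2 (hF_pos e)).le (jumpForm_nonneg o e u)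

theorem jumpV_eq_zero_of_penForm (o : Orientation M) (u : P1 M) (h : penForm o u u = 0)
    (e : IFace M) : ∀ x ∈ e.cell, jumpV o u e x = 0 := by
  rw [penForm_apply, Finset.sum_eq_zero_iff_of_nonneg fun e _ =>
    mul_nonneg (one_div_pos.2 (hF_pos e)).le (jumpForm_nonneg o e u)] at h
  have := h e (Finset.mem_univ e)
  exact jumpV_eq_zero o e u ((mul_eq_zero.1 this).resolve_left (one_div_pos.2 (hF_pos e)).ne')

/-- The consistency term `∑ₑ ⟨{σₑ(u) nₑ}, [v]⟩ₑ`. -/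
def stressJump (o : Orientation M) (η γ : ℝ) : LinearMap.BilinForm ℝ (P1 M) :=
  LinearMap.mk₂ ℝ (fun u v => ∑ e, inner ℝ (avgStressN o η γ u e) (jumpMean o e v))
    (fun u u' v => by
      simp only [avgStressN_add, inner_add_left, Finset.sum_add_distrib])
    (fun r u v => by
      simp only [avgStressN_smul, real_inner_smul_left, smul_eq_mul, Finset.mul_sum])
    (fun u v v' => by
      simp only [map_add, inner_add_right, Finset.sum_add_distrib])
    (fun r u v => by
      simp only [map_smul, real_inner_smul_right, smul_eq_mul, Finset.mul_sum])

theorem stressJump_apply (o : Orientation M) (η γ : ℝ) (u v : P1 M) :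
    stressJump o η γ u v = ∑ e, inner ℝ (avgStressN o η γ u e) (jumpMean o e v) := rfl

/-- The elastic part of the form `𝒜`. -/
def elasticForm (o : Orientation M) (η γ ς : ℝ) : LinearMap.BilinForm ℝ (P1 M) :=
  (2 * η) • strainForm + γ • divForm - stressJump o η γ - (stressJump o η γ).flip + ς • penForm o

theorem elasticForm_apply (o : Orientation M) (η γ ς : ℝ) (u v : P1 M) :
    elasticForm o η γ ς u v = 2 * η * strainForm u v + γ * divForm u v - stressJump o η γ u v
      - stressJump o η γ v u + ς * penForm o u v := rfl

theorem elasticForm_comm (o : Orientation M) (η γ ς : ℝ) (u v : P1 M) :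
    elasticForm o η γ ς u v = elasticForm o η γ ς v u := by
  simp only [elasticForm_apply, strainForm_comm u v, divForm_comm u v, penForm_comm o u v]
  ring

/-- The discrete divergence `∑_K (r, ∇·v)_K - ∑ₑ ⟨{r nₑ}, [v]⟩ₑ`, through which the pressure and the
displacement are coupled. -/
def coupling (o : Orientation M) : P1 M →ₗ[ℝ] P0 M →ₗ[ℝ] ℝ :=
  LinearMap.mk₂ ℝ (fun v r => ∑ K, vol K * (r K * divg (v K))
      - ∑ e, inner ℝ (avgN o r e) (jumpMean o e v))
    (fun u v r => by
      simp only [Pi.add_apply, divg_add, mul_add, map_add, inner_add_right,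
        Finset.sum_add_distrib]
      ring)
    (fun c v r => by
      simp only [Pi.smul_apply, divg_smul, map_smul, real_inner_smul_right, smul_eq_mul, mul_sub,
        Finset.mul_sum]
      congr 1
      exact Finset.sum_congr rfl fun K _ => by ring)
    (fun v r s => by
      simp only [Pi.add_apply, add_mul, mul_add, avgN_add, inner_add_left, Finset.sum_add_distrib]
      ring)
    (fun c v r => by
      simp only [Pi.smul_apply, avgN_smul, real_inner_smul_left, smul_eq_mul, mul_sub,
        Finset.mul_sum]
      congr 1
      exact Finset.sum_congr rfl fun K _ => by ring)

theorem coupling_apply (o : Orientation M) (v : P1 M) (r : P0 M) :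
    coupling o v r = ∑ K, vol K * (r K * divg (v K))
      - ∑ e, inner ℝ (avgN o r e) (jumpMean o e v) := rfl

theorem formA_eq (o : Orientation M) (P : Physical) (t : Tuning) (u : P1 M) (p : P0 M) (v : P1 M) :
    formA o P t u p v = elasticForm o P.η t.γ t.ς₂ u v - P.α * coupling o v p := by
  have h1 : (∑ K, intK K fun _ => frob (stress P.η t.γ (u K)) (strain (v K))) =
      2 * P.η * strainForm u v + t.γ * divForm u v := by
    simp only [intK_const, frob_stress_strain, strainForm_apply, divForm_apply, Finset.mul_sum,
      ← Finset.sum_add_distrib]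
    exact Finset.sum_congr rfl fun K _ => by ring
  have h2 : (∑ e, t.ς₂ / hF e * intF e fun x => inner ℝ (jumpV o u e x) (jumpV o v e x)) =
      t.ς₂ * penForm o u v := by
    simp only [penForm_apply, jumpForm_apply, Finset.mul_sum]
    exact Finset.sum_congr rfl fun K _ => by ring
  rw [formA, h1, h2, elasticForm_apply, coupling_apply, stressJump_apply, stressJump_apply]
  simp only [intF_inner_jumpV, intF_jumpV_inner, intK_const]
  ring

/-- For a large penalty parameter the elasticity form controls the strain, and, with the factor `γ`,
the divergence and the jumps. -/
theorem exists_penalty_coercive (o : Orientation M) {η : ℝ} (hη : 0 < η) (γ : ℝ) :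
    ∃ ς₀ > 0, ∀ ς ≥ ς₀, ∀ v : P1 M, η * strainForm v v + γ * (divForm v v + penForm o v v) ≤
      elasticForm o η γ ς v v := by
  let s : IFace M × Fin d → P1 M →ₗ[ℝ] ℝ := fun i =>
    { toFun := fun v => avgStressN o η γ v i.1 i.2
      map_add' := fun u v => by rw [avgStressN_add]; rfl
      map_smul' := fun r v => by rw [avgStressN_smul]; rfl }
  let j : IFace M × Fin d → P1 M →ₗ[ℝ] ℝ := fun i =>
    { toFun := fun v => jumpMean o i.1 v i.2
      map_add' := fun u v => by rw [map_add]; rfl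
      map_smul' := fun r v => by rw [map_smul]; rfl }
  obtain ⟨Cs, hCs, hs⟩ := exists_sq_le_form_family strainForm strainForm_comm strainForm_nonneg s
    (fun i v hv => by
      change avgStressN o η γ v i.1 i.2 = 0
      rw [avgStressN_eq_zero o η γ v i.1 (strain_eq_zero v hv)]
      rfl)
  obtain ⟨Cj, hCj, hj⟩ := exists_sq_le_form_family (penForm o) (penForm_comm o) (penForm_nonneg o) j
    (fun i v hv => by
      change jumpMean o i.1 v i.2 = 0
      rw [jumpMean_eq_zero o i.1 v (jumpV_eq_zero_of_penForm o v hv i.1)]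
      rfl)
  have hT : ∀ v : P1 M, stressJump o η γ v v = ∑ i, s i v * j i v := fun v => by
    rw [stressJump_apply, Fintype.sum_prod_type]
    refine Finset.sum_congr rfl fun e _ => ?_
    rw [PiLp.inner_apply]
    exact Finset.sum_congr rfl fun i _ => mul_comm _ _
  -- Young's inequality with the weight `δ` leaves half of the strain term `2 η ‖ε(v)‖²`.
  set δ := η / (Cs + 1) with hδ
  have hδ0 : 0 < δ := div_pos hη (by linarith)
  have hδC : δ * Cs ≤ η := by
    rw [hδ, div_mul_eq_mul_div, div_le_iff₀ (by linarith)]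
    nlinarith
  refine ⟨Cj / δ + |γ| + 1, by positivity, fun ς hς v => ?_⟩
  have hY : 2 * stressJump o η γ v v ≤ η * strainForm v v + Cj / δ * penForm o v v := by
    calc 2 * stressJump o η γ v v = ∑ i, 2 * (s i v * j i v) := by rw [hT, Finset.mul_sum]
      _ ≤ ∑ i, (δ * s i v ^ 2 + 1 / δ * j i v ^ 2) := by
          refine Finset.sum_le_sum fun i _ => ?_
          have h : 0 ≤ (δ * s i v - j i v) ^ 2 / δ := div_nonneg (sq_nonneg _) hδ0.le
          have h2 : (δ * s i v - j i v) ^ 2 / δ =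
              δ * s i v ^ 2 + 1 / δ * j i v ^ 2 - 2 * (s i v * j i v) := by
            field_simp
            ring
          linarith
      _ = δ * ∑ i, s i v ^ 2 + 1 / δ * ∑ i, j i v ^ 2 := by
          rw [Finset.sum_add_distrib, Finset.mul_sum, Finset.mul_sum]
      _ ≤ δ * (Cs * strainForm v v) + 1 / δ * (Cj * penForm o v v) := by
          gcongr
          · exact hs v
          · exact hj v
      _ ≤ η * strainForm v v + Cj / δ * penForm o v v := by
          have h1 := mul_le_mul_of_nonneg_right hδC (strainForm_nonneg v)
          have h2 : 1 / δ * (Cj * penForm o v v) = Cj / δ * penForm o v v := by ring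
          linarith
  have h3 : (Cj / δ + γ) * penForm o v v ≤ ς * penForm o v v :=
    mul_le_mul_of_nonneg_right (by linarith [le_abs_self γ]) (penForm_nonneg o v)
  rw [elasticForm_apply]
  linarith

theorem coupling_eq_zero (o : Orientation M) (v : P1 M) (hd : ∀ K, divg (v K) = 0)
    (hj : ∀ e : IFace M, ∀ x ∈ e.cell, jumpV o v e x = 0) (r : P0 M) : coupling o v r = 0 := by
  simp [coupling_apply, hd, jumpMean_eq_zero o _ v (hj _)]

/-- The discrete divergence is bounded by the divergence and the jumps, with a constant that depends
neither on `γ` nor on the penalty parameter. -/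
theorem exists_coupling_sq_le (o : Orientation M) : ∃ C, 0 ≤ C ∧ ∀ (v : P1 M) (r : P0 M),
    coupling o v r ^ 2 ≤ C * (divForm v v + penForm o v v) * l2SqQ r := by
  classical
  obtain ⟨m, hm, hmK⟩ := exists_vol_lower M
  have hnn : ∀ v : P1 M, 0 ≤ (divForm + penForm o : LinearMap.BilinForm ℝ (P1 M)) v v := fun v =>
    add_nonneg (divForm_nonneg v) (penForm_nonneg o v)
  obtain ⟨C, hC, h⟩ := exists_sq_le_form_family (divForm + penForm o)
    (fun u v => by
      simp only [LinearMap.add_apply, divForm_comm u v, penForm_comm o u v])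
    hnn (fun K : Elem M => (coupling o).flip (Pi.single K 1)) (fun K v hv => by
      have hv' : divForm v v + penForm o v v = 0 := hv
      have h1 : divForm v v = 0 := by linarith [divForm_nonneg v, penForm_nonneg o v]
      have h2 : penForm o v v = 0 := by linarith
      exact coupling_eq_zero o v (divg_eq_zero v h1) (jumpV_eq_zero_of_penForm o v h2) _)
  refine ⟨C / m, by positivity, fun v r => ?_⟩
  have hr : coupling o v r = ∑ K, r K * coupling o v (Pi.single K 1) := by
    conv_lhs => rw [pi_eq_sum_univ' r]
    simp only [map_sum, map_smul, smul_eq_mul]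
  have hr2 : ∑ K, r K ^ 2 ≤ l2SqQ r / m := by
    rw [le_div_iff₀ hm, Finset.sum_mul, l2SqQ_eq]
    refine Finset.sum_le_sum fun K _ => ?_
    rw [mul_comm]
    exact mul_le_mul_of_nonneg_right (hmK K) (sq_nonneg _)
  calc coupling o v r ^ 2 ≤ (∑ K, r K ^ 2) * ∑ K, coupling o v (Pi.single K 1) ^ 2 := by
        rw [hr]
        exact Finset.sum_mul_sq_le_sq_mul_sq _ _ _
    _ ≤ (l2SqQ r / m) * (C * (divForm v v + penForm o v v)) :=
        mul_le_mul hr2 (h v) (Finset.sum_nonneg fun _ _ => sq_nonneg _)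
          (div_nonneg (l2SqQ_nonneg r) hm.le)
    _ = C / m * (divForm v v + penForm o v v) * l2SqQ r := by ring

/-- What the elasticity form contributes to the analysis of the scheme: the discrete momentum balance
determines the displacement modulo rigid displacements, and the volumetric strain it produces is of
size `C / γ` relative to the pressure. -/
structure ElasticBounds (o : Orientation M) (P : Physical) (t : Tuning) (C : ℝ) : Prop where
  exists_displacement : ∀ p : P0 M, ∃ u, ∀ v, formA o P t u p v = 0
  rigid : ∀ u : P1 M, (∀ v, formA o P t u 0 v = 0) → IsRigid o u
  coupling_le : ∀ (u : P1 M) (p : P0 M), (∀ v, formA o P t u p v = 0) → ∀ r,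
    (P.α * coupling o u r) ^ 2 ≤ (C / t.γ) ^ 2 * l2SqQ p * l2SqQ r

theorem exists_elasticBounds (o : Orientation M) (P : Physical) : ∃ C, 0 ≤ C ∧ ∀ γ > 0, ∃ ς₀ > 0,
    ∀ t : Tuning, t.γ = γ → ς₀ ≤ t.ς₂ → ElasticBounds o P t C := by
  obtain ⟨Cb, hCb, hb⟩ := exists_coupling_sq_le o
  refine ⟨P.α ^ 2 * Cb, by positivity, fun γ hγ => ?_⟩
  obtain ⟨ς₀, hς₀, hc⟩ := exists_penalty_coercive o P.η_pos γ
  refine ⟨ς₀, hς₀, ?_⟩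
  rintro t rfl ht
  have hpos : ∀ v : P1 M, P.η * strainForm v v + t.γ * (divForm v v + penForm o v v) ≤
      elasticForm o P.η t.γ t.ς₂ v v := hc _ ht
  have hrigid : ∀ v : P1 M, elasticForm o P.η t.γ t.ς₂ v v = 0 → IsRigid o v := by
    intro v hv
    have h0 := hpos v
    have h1 := mul_nonneg P.η_pos.le (strainForm_nonneg v)
    have h2 := mul_nonneg hγ.le (divForm_nonneg v)
    have h3 := mul_nonneg hγ.le (penForm_nonneg o v)
    have h4 : P.η * strainForm v v = 0 := by linarith
    have h5 : t.γ * penForm o v v = 0 := by linarith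
    exact ⟨strain_eq_zero v ((mul_eq_zero.1 h4).resolve_left P.η_pos.ne'),
      jumpV_eq_zero_of_penForm o v ((mul_eq_zero.1 h5).resolve_left hγ.ne')⟩
  refine ⟨fun p => ?_, fun u hu => ?_, fun u p hu r => ?_⟩
  · obtain ⟨u, hu⟩ := exists_form_eq (elasticForm o P.η t.γ t.ς₂) (elasticForm_comm o _ _ _)
      (P.α • (coupling o).flip p) (fun v hv => by
        have h := hrigid v hv
        have : coupling o v p = 0 := coupling_eq_zero o v
          (fun K => by rw [← trace_strain, h.1 K, Matrix.trace_zero]) h.2 p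
        simp [this])
    refine ⟨u, fun v => ?_⟩
    rw [formA_eq, hu]
    simp
  · refine hrigid u ?_
    have := hu u
    rw [formA_eq, map_zero] at this
    linarith
  · have h1 : elasticForm o P.η t.γ t.ς₂ u u = P.α * coupling o u p := by
      have := hu u
      rw [formA_eq] at this
      linarith
    have h2 := hpos u
    have h3 := mul_nonneg P.η_pos.le (strainForm_nonneg u)
    set D := divForm u u + penForm o u u with hD
    have hD0 : 0 ≤ D := add_nonneg (divForm_nonneg u) (penForm_nonneg o u)
    have h4 : t.γ * D ≤ P.α * coupling o u p := by linarith
    have h5 := hb u p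
    have h6 := hb u r
    rw [← hD] at h5 h6
    have hp := l2SqQ_nonneg p
    have hr := l2SqQ_nonneg r
    have h7 : (t.γ * D) ^ 2 ≤ P.α ^ 2 * (Cb * D * l2SqQ p) := by
      calc (t.γ * D) ^ 2 ≤ (P.α * coupling o u p) ^ 2 := by
            gcongr
        _ = P.α ^ 2 * coupling o u p ^ 2 := by ring
        _ ≤ _ := mul_le_mul_of_nonneg_left h5 (sq_nonneg _)
    have h8 : t.γ ^ 2 * D ≤ P.α ^ 2 * Cb * l2SqQ p := by
      rcases hD0.eq_or_lt with h | h
      · rw [← h, mul_zero]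
        positivity
      · refine le_of_mul_le_mul_right ?_ h
        linarith
    have h9 : D ≤ P.α ^ 2 * Cb * l2SqQ p / t.γ ^ 2 := by
      rw [le_div_iff₀ (by positivity)]
      linarith
    calc (P.α * coupling o u r) ^ 2 = P.α ^ 2 * coupling o u r ^ 2 := by ring
      _ ≤ P.α ^ 2 * (Cb * (P.α ^ 2 * Cb * l2SqQ p / t.γ ^ 2) * l2SqQ r) := by
          refine mul_le_mul_of_nonneg_left (h6.trans ?_) (sq_nonneg _)
          gcongr
      _ = (P.α ^ 2 * Cb / t.γ) ^ 2 * l2SqQ p * l2SqQ r := by ring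

end Elasticity

/-! ### Convection, Darcy flow and the algebraic form of the scheme -/

section Flow

variable {d : ℕ} {Ω : Set (E d)} {M : Triangulation d Ω}

/-- The jump form `∑ₑ [p]ₑ [q]ₑ` on piecewise constant functions. -/
def jumpProd (o : Orientation M) : LinearMap.BilinForm ℝ (P0 M) :=
  LinearMap.mk₂ ℝ (fun p q => ∑ e, jumpQ o p e * jumpQ o q e)
    (fun p p' q => by
      rw [← Finset.sum_add_distrib]
      exact Finset.sum_congr rfl fun e _ => by simp only [jumpQ, Pi.add_apply]; ring)
    (fun r p q => by
      rw [smul_eq_mul, Finset.mul_sum]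
      exact Finset.sum_congr rfl fun e _ => by simp only [jumpQ, Pi.smul_apply, smul_eq_mul]; ring)
    (fun p q q' => by
      rw [← Finset.sum_add_distrib]
      exact Finset.sum_congr rfl fun e _ => by simp only [jumpQ, Pi.add_apply]; ring)
    (fun r p q => by
      rw [smul_eq_mul, Finset.mul_sum]
      exact Finset.sum_congr rfl fun e _ => by simp only [jumpQ, Pi.smul_apply, smul_eq_mul]; ring)

theorem jumpProd_apply (o : Orientation M) (p q : P0 M) :
    jumpProd o p q = ∑ e, jumpQ o p e * jumpQ o q e := rfl

theorem jumpProd_comm (o : Orientation M) (p q : P0 M) : jumpProd o p q = jumpProd o q p := by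
  simp only [jumpProd_apply, mul_comm (jumpQ o p _)]

theorem jumpProd_nonneg (o : Orientation M) (p : P0 M) : 0 ≤ jumpProd o p p :=
  Finset.sum_nonneg fun _ _ => mul_self_nonneg _

/-- The velocity form `(λ⁻¹(φⁿ) u, w)`. -/
def darcyForm (P : Physical) (old : Level M) : LinearMap.BilinForm ℝ (P1 M) :=
  ∑ K, (P.mob (old.phi K))⁻¹ • cellForm K

theorem darcyForm_apply (P : Physical) (old : Level M) (u v : P1 M) :
    darcyForm P old u v = ∑ K, (P.mob (old.phi K))⁻¹ * cellForm K u v := by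
  simp [darcyForm, LinearMap.sum_apply]

theorem darcyForm_comm (P : Physical) (old : Level M) (u v : P1 M) :
    darcyForm P old u v = darcyForm P old v u := by
  simp only [darcyForm_apply, cellForm_comm _ u v]

/-- The slope of `c` as an affine function of the stabilized chemical potential. -/
def slope (P : Physical) (t : Tuning) (old : Level M) (K : Elem M) : ℝ :=
  old.c K * (1 - P.β * old.c K) ^ 2 / (t.θ * P.R * P.T)

variable [NeZero d]

/-- The convection form `∑ₑ ⟨c^{n*} u · nₑ, [q]⟩ₑ`. -/
def convection (o : Orientation M) (old : Level M) : P0 M →ₗ[ℝ] P1 M →ₗ[ℝ] ℝ :=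
  LinearMap.mk₂ ℝ (fun q u => ∑ e, upwind o old e * flux o e u * jumpQ o q e)
    (fun p q u => by
      rw [← Finset.sum_add_distrib]
      exact Finset.sum_congr rfl fun e _ => by simp only [jumpQ, Pi.add_apply]; ring)
    (fun r p u => by
      rw [smul_eq_mul, Finset.mul_sum]
      exact Finset.sum_congr rfl fun e _ => by simp only [jumpQ, Pi.smul_apply, smul_eq_mul]; ring)
    (fun p u v => by
      rw [← Finset.sum_add_distrib]
      exact Finset.sum_congr rfl fun e _ => by simp only [map_add]; ring)
    (fun r p u => by
      rw [smul_eq_mul, Finset.mul_sum]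
      exact Finset.sum_congr rfl fun e _ => by simp only [map_smul, smul_eq_mul]; ring)

theorem convection_apply (o : Orientation M) (old : Level M) (q : P0 M) (u : P1 M) :
    convection o old q u = ∑ e, upwind o old e * flux o e u * jumpQ o q e := rfl

/-- The scheme with all integrals evaluated. -/
theorem equations_iff (o : Orientation M) (P : Physical) (t : Tuning) (old lag new : Level M)
    (hτ : t.τ ≠ 0) : Equations o P t old lag new ↔
      new.uf ∈ RT0 M ∧
      (∀ K, new.mu K = P.mu (old.c K) +
        t.θ * P.R * P.T * ((new.c K - old.c K) / (old.c K * (1 - P.β * old.c K) ^ 2))) ∧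
      (∀ v, formA o P t new.us new.p v = 0) ∧
      (∀ q, qForm (lag.phi * new.c - old.phi * old.c) q +
        t.τ * (convection o old q lag.uf + t.ς₁ * jumpProd o new.mu q) = 0) ∧
      (∀ w ∈ RT0 M, darcyForm P old new.uf w = convection o old new.mu w) ∧
      (∀ K, new.p K = old.c K * new.mu K - P.f (old.c K)) ∧
      (∀ r, qForm (new.phi - old.phi) r =
        1 / t.N * qForm (new.p - old.p) r + P.α * coupling o (new.us - old.us) r) := by
  classical
  have hmass : ∀ q : P0 M,
      (∑ K, intK K fun _ => (lag.phi K * new.c K - old.phi K * old.c K) / t.τ * q K)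
      + (∑ e, intF e fun x =>
        upwind o old e * inner ℝ (lag.uf (o.fst e) x) (o.normal e) * jumpQ o q e)
      + (∑ e, t.ς₁ / hF e * intF e fun _ => jumpQ o new.mu e * jumpQ o q e) =
      t.τ⁻¹ * (qForm (lag.phi * new.c - old.phi * old.c) q +
        t.τ * (convection o old q lag.uf + t.ς₁ * jumpProd o new.mu q)) := by
    intro q
    have h1 : (∑ K, intK K fun _ => (lag.phi K * new.c K - old.phi K * old.c K) / t.τ * q K) =
        t.τ⁻¹ * qForm (lag.phi * new.c - old.phi * old.c) q := by
      simp only [intK_const, qForm_apply, Finset.mul_sum, Pi.sub_apply, Pi.mul_apply]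
      exact Finset.sum_congr rfl fun K _ => by ring
    have h2 : (∑ e, intF e fun x =>
        upwind o old e * inner ℝ (lag.uf (o.fst e) x) (o.normal e) * jumpQ o q e) =
        convection o old q lag.uf := by
      rw [convection_apply]
      refine Finset.sum_congr rfl fun e _ => ?_
      rw [flux_apply, mul_assoc, mul_comm (intF e _), ← mul_assoc, ← intF_mul_left]
      congr 1
      funext x
      ring
    have h3 : (∑ e, t.ς₁ / hF e * intF e fun _ => jumpQ o new.mu e * jumpQ o q e) =
        t.ς₁ * jumpProd o new.mu q := by
      simp only [intF_const, jumpProd_apply, Finset.mul_sum]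
      refine Finset.sum_congr rfl fun e _ => ?_
      have := (hF_pos e).ne'
      field_simp
    rw [h1, h2, h3]
    field_simp
    ring
  have hdarcy : ∀ w : P1 M,
      (∑ K, intK K fun x => (P.mob (old.phi K))⁻¹ * inner ℝ (new.uf K x) (w K x)) =
        darcyForm P old new.uf w ∧
      (∑ e, intF e fun x =>
        jumpQ o new.mu e * (upwind o old e * inner ℝ (w (o.fst e) x) (o.normal e))) =
        convection o old new.mu w := by
    intro w
    constructor
    · rw [darcyForm_apply]
      exact Finset.sum_congr rfl fun K _ => integral_const_mul _ _
    · rw [convection_apply]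
      refine Finset.sum_congr rfl fun e _ => ?_
      rw [flux_apply, intF_mul_left, intF_mul_left]
      ring
  have hpres : (∀ z : P0 M, (∑ K, intK K fun _ => new.p K * z K) =
      ∑ K, intK K fun _ => (old.c K * new.mu K - P.f (old.c K)) * z K) ↔
      ∀ K, new.p K = old.c K * new.mu K - P.f (old.c K) := by
    simp only [intK_const]
    constructor
    · intro h K
      have h1 := h (Pi.single K 1)
      simp only [Pi.single_apply, mul_ite, mul_one, mul_zero, Finset.sum_ite_eq', Finset.mem_univ,
        if_true] at h1
      exact mul_left_cancel₀ (vol_pos K).ne' h1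
    · intro h z
      exact Finset.sum_congr rfl fun K _ => by rw [h K]
  have hpor : ∀ r : P0 M,
      (∑ K, intK K fun _ => (new.phi K - old.phi K) / t.τ * r K) =
        t.τ⁻¹ * qForm (new.phi - old.phi) r ∧
      1 / t.N * (∑ K, intK K fun _ => (new.p K - old.p K) / t.τ * r K)
        + P.α * (∑ K, intK K fun _ => (divg (new.us K) - divg (old.us K)) / t.τ * r K)
        - P.α * (∑ e, intF e fun x =>
          inner ℝ (avgN o r e) ((1 / t.τ) • (jumpV o new.us e x - jumpV o old.us e x))) =
        t.τ⁻¹ * (1 / t.N * qForm (new.p - old.p) r + P.α * coupling o (new.us - old.us) r) := by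
    intro r
    have hd : ∀ K, divg (new.us K) - divg (old.us K) = divg ((new.us - old.us) K) := fun K => by
      rw [Pi.sub_apply, sub_eq_add_neg, sub_eq_add_neg, ← neg_one_smul ℝ (old.us K), divg_add,
        divg_smul]
      ring
    have hj : ∀ e x, jumpV o new.us e x - jumpV o old.us e x = jumpV o (new.us - old.us) e x :=
      fun e x => by
        rw [sub_eq_add_neg new.us, ← neg_one_smul ℝ old.us, jumpV_add, jumpV_smul, neg_one_smul,
          sub_eq_add_neg]
    constructor
    · simp only [intK_const, qForm_apply, Finset.mul_sum, Pi.sub_apply]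
      exact Finset.sum_congr rfl fun K _ => by ring
    · have h1 : (∑ K, intK K fun _ => (new.p K - old.p K) / t.τ * r K) =
          t.τ⁻¹ * qForm (new.p - old.p) r := by
        simp only [intK_const, qForm_apply, Finset.mul_sum, Pi.sub_apply]
        exact Finset.sum_congr rfl fun K _ => by ring
      have h2 : (∑ K, intK K fun _ => (divg (new.us K) - divg (old.us K)) / t.τ * r K) =
          t.τ⁻¹ * ∑ K, vol K * (r K * divg ((new.us - old.us) K)) := by
        simp only [intK_const, Finset.mul_sum, hd]
        exact Finset.sum_congr rfl fun K _ => by ring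
      have h3 : (∑ e, intF e fun x =>
          inner ℝ (avgN o r e) ((1 / t.τ) • (jumpV o new.us e x - jumpV o old.us e x))) =
          t.τ⁻¹ * ∑ e, inner ℝ (avgN o r e) (jumpMean o e (new.us - old.us)) := by
        simp only [hj, real_inner_smul_right, intF_mul_left, intF_inner_jumpV, Finset.mul_sum,
          one_div]
      rw [h1, h2, h3, coupling_apply]
      ring
  have hτi : t.τ⁻¹ ≠ 0 := inv_ne_zero hτ
  constructor
  · intro h
    refine ⟨h.velocity_mem, h.potential, h.momentum, fun q => ?_, fun w hw => ?_,
      hpres.1 h.pressure, fun r => ?_⟩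
    · have := h.mass q
      rw [hmass] at this
      exact (mul_eq_zero.1 this).resolve_left hτi
    · have := h.darcy w hw
      rwa [(hdarcy w).1, (hdarcy w).2] at this
    · have := h.porosity r
      rw [(hpor r).1, (hpor r).2] at this
      exact mul_left_cancel₀ hτi this
  · rintro ⟨h1, h2, h3, h4, h5, h6, h7⟩
    refine ⟨h1, h2, h3, fun q => ?_, fun w hw => ?_, hpres.2 h6, fun r => ?_⟩
    · rw [hmass, h4, mul_zero]
    · rw [(hdarcy w).1, (hdarcy w).2, h5 w hw]
    · rw [(hpor r).1, (hpor r).2, h7]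

end Flow

/-! ### Bounds that are uniform in the previous time level -/

section Bounds

theorem contDiffAt_f (P : Physical) {c : ℝ} (hc : 0 < c) (hc' : P.β * c < 1) :
    ContDiffAt ℝ 1 P.f c := by
  have h2 : Real.sqrt 2 < 2 := by
    rw [Real.sqrt_lt' (by norm_num)]
    norm_num
  have hβc : 0 < P.β * c := mul_pos P.β_pos hc
  have hs : 0 ≤ Real.sqrt 2 := Real.sqrt_nonneg 2
  have hnum : 1 + (1 - Real.sqrt 2) * P.β * c ≠ 0 := by
    have : 0 < 1 + (1 - Real.sqrt 2) * P.β * c := by nlinarith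
    exact this.ne'
  have hden : 1 + (1 + Real.sqrt 2) * P.β * c ≠ 0 := by
    have : 0 < 1 + (1 + Real.sqrt 2) * P.β * c := by nlinarith
    exact this.ne'
  have hid : ContDiffAt ℝ 1 (fun c : ℝ => c) c := contDiffAt_id
  have hlin : ∀ k : ℝ, ContDiffAt ℝ 1 (fun c : ℝ => k * c) c := fun k => contDiffAt_const.mul hid
  unfold Physical.f
  refine ContDiffAt.add (ContDiffAt.add ?_ ?_) ?_
  · exact ((hid.mul contDiffAt_const).mul contDiffAt_const).mul (hid.log hc.ne')
  · exact (((hid.mul contDiffAt_const).mul contDiffAt_const).mul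
      ((contDiffAt_const.sub (hlin _)).log (by linarith))).neg
  · refine ((hlin _).div_const _).mul (ContDiffAt.log ?_ (div_ne_zero hnum hden))
    exact (contDiffAt_const.add (hlin _)).div (contDiffAt_const.add (hlin _)) hden

theorem exists_f_mu_bound (P : Physical) {ϱ₀ ϱ : ℝ} (h₀ : 0 < ϱ₀) (h₁ : ϱ < 1) :
    ∃ C, 0 ≤ C ∧ ∀ c, ϱ₀ ≤ P.β * c → P.β * c ≤ ϱ → |P.f c| ≤ C ∧ |P.mu c| ≤ C := by
  set S := Set.Icc (ϱ₀ / P.β) (ϱ / P.β) with hS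
  have hU : IsOpen {c : ℝ | 0 < c ∧ P.β * c < 1} :=
    (isOpen_lt continuous_const continuous_id).inter
      (isOpen_lt (continuous_const.mul continuous_id) continuous_const)
  have hSU : S ⊆ {c : ℝ | 0 < c ∧ P.β * c < 1} := fun c hc => by
    refine ⟨(div_pos h₀ P.β_pos).trans_le hc.1, ?_⟩
    have := (le_div_iff₀ P.β_pos).1 hc.2
    linarith
  have hf : ContDiffOn ℝ 1 P.f {c : ℝ | 0 < c ∧ P.β * c < 1} := fun c hc =>
    (contDiffAt_f P hc.1 hc.2).contDiffWithinAt
  have hd : ContinuousOn P.mu {c : ℝ | 0 < c ∧ P.β * c < 1} :=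
    hf.continuousOn_deriv_of_isOpen hU le_rfl
  obtain ⟨C₁, hC₁⟩ := isCompact_Icc.exists_bound_of_continuousOn (hf.continuousOn.mono hSU)
  obtain ⟨C₂, hC₂⟩ := isCompact_Icc.exists_bound_of_continuousOn (hd.mono hSU)
  refine ⟨max (max C₁ C₂) 0, le_max_right _ _, fun c h h' => ?_⟩
  have hc : c ∈ S :=
    ⟨(div_le_iff₀ P.β_pos).2 (by linarith), (le_div_iff₀ P.β_pos).2 (by linarith)⟩
  exact ⟨(hC₁ c hc).trans ((le_max_left _ _).trans (le_max_left _ _)),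
    (hC₂ c hc).trans ((le_max_right _ _).trans (le_max_left _ _))⟩

theorem mob_pos (P : Physical) {φ : ℝ} (h : 0 < φ) (h' : φ < 1) : 0 < P.mob φ := by
  have h1 := P.κ₀_pos
  have h2 := P.ν_pos
  have h3 := P.φr_pos
  have h4 : 0 < 1 - P.φr := by linarith [P.φr_lt_one]
  have h5 : 0 < 1 - φ := by linarith
  unfold Physical.mob
  positivity

theorem exists_mob_bound (P : Physical) {φmin φmax : ℝ} (h₀ : 0 < φmin) (h₁ : φmax < 1) :
    ∃ C > 0, ∀ φ, φmin ≤ φ → φ ≤ φmax → P.mob φ ≤ C ∧ (P.mob φ)⁻¹ ≤ C := by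
  have hc : ContinuousOn P.mob (Set.Icc φmin φmax) := by
    unfold Physical.mob
    refine ContinuousOn.div_const (ContinuousOn.mul ?_ ?_) _
    · fun_prop
    · refine ContinuousOn.pow (ContinuousOn.div ?_ ?_ fun φ hφ => ?_) _
      · fun_prop
      · fun_prop
      · linarith [hφ.2]
  have hi : ContinuousOn (fun φ => (P.mob φ)⁻¹) (Set.Icc φmin φmax) :=
    hc.inv₀ fun φ hφ => (mob_pos P (h₀.trans_le hφ.1) (hφ.2.trans_lt h₁)).ne'
  obtain ⟨C₁, hC₁⟩ := isCompact_Icc.exists_bound_of_continuousOn hc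
  obtain ⟨C₂, hC₂⟩ := isCompact_Icc.exists_bound_of_continuousOn hi
  -- The maximum with `1` matters when the interval of porosities is empty.
  refine ⟨max (max C₁ C₂) 1, lt_of_lt_of_le one_pos (le_max_right _ _), fun φ h h' => ?_⟩
  exact ⟨(le_abs_self _).trans ((hC₁ φ ⟨h, h'⟩).trans ((le_max_left _ _).trans (le_max_left _ _))),
    (le_abs_self _).trans ((hC₂ φ ⟨h, h'⟩).trans ((le_max_right _ _).trans (le_max_left _ _)))⟩

variable {d : ℕ} {Ω : Set (E d)} {M : Triangulation d Ω}

theorem upwind_sq_le (o : Orientation M) (old : Level M) {c₁ : ℝ} (h₀ : ∀ K, 0 < old.c K)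
    (h : ∀ K, old.c K ≤ c₁) (e : IFace M) : upwind o old e ^ 2 ≤ c₁ ^ 2 := by
  unfold upwind
  split_ifs
  · exact pow_le_pow_left₀ (h₀ _).le (h _) 2
  · exact pow_le_pow_left₀ (h₀ _).le (h _) 2

variable [NeZero d]

theorem exists_flux_sq_le (o : Orientation M) : ∃ C, 0 ≤ C ∧ ∀ u : P1 M,
    ∑ e, flux o e u ^ 2 ≤ C * l2SqV u := by
  obtain ⟨C, hC, h⟩ := exists_sq_le_form_family l2Form l2Form_comm l2Form_nonneg (flux o)
    fun e u hu => by rw [eq_zero_of_l2Form u hu, map_zero]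
  exact ⟨C, hC, fun u => by rw [l2SqV_eq]; exact h u⟩

/-- Bounds on the data of one time step: `s₀`, `s₁` for the slope of `c` as a function of `μ`; `c₁`
for the density `cⁿ`; `m` for `μ(cⁿ)`, `f(cⁿ)` and `pⁿ`; `H` for the convection form relative to the
jumps and the velocity form; `ω` for the equivalence of the velocity form and the `L²` norm. -/
structure StepBounds (o : Orientation M) (P : Physical) (t : Tuning) (old : Level M)
    (s₀ s₁ c₁ m H ω : ℝ) : Prop where
  slope_lower : ∀ K, s₀ ≤ slope P t old K
  slope_upper : ∀ K, slope P t old K ≤ s₁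
  density_pos : ∀ K, 0 < old.c K
  density : ∀ K, old.c K ≤ c₁
  potential : ∀ K, |P.mu (old.c K)| ≤ m
  energy : ∀ K, |P.f (old.c K)| ≤ m
  pressure : ∀ K, |old.p K| ≤ m
  potential_iff : ∀ K x c, (x = P.mu (old.c K) +
    t.θ * P.R * P.T * ((c - old.c K) / (old.c K * (1 - P.β * old.c K) ^ 2))) ↔
    c = old.c K + slope P t old K * (x - P.mu (old.c K))
  darcy_nonneg : ∀ u : P1 M, 0 ≤ darcyForm P old u u
  darcy_le : ∀ u : P1 M, darcyForm P old u u ≤ ω * l2SqV u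
  le_darcy : ∀ u : P1 M, l2SqV u ≤ ω * darcyForm P old u u
  convection_sq_le : ∀ q u, convection o old q u ^ 2 ≤ H * jumpProd o q q * darcyForm P old u u

theorem exists_stepBounds (o : Orientation M) (P : Physical) {ϱ₀ ϱ φmin φmax pmax θmax : ℝ}
    (hϱ₀ : 0 < ϱ₀) (hϱ : ϱ < 1) (hφmin : 0 < φmin) (hφmax : φmax < 1) :
    ∃ s₀ > 0, ∃ s₁ > 0, ∃ m ≥ 0, ∃ H > 0, ∃ ω > 0, ∀ t : Tuning, 1 ≤ t.θ → t.θ ≤ θmax →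
      ∀ old : Level M, IsPreviousLevel o P t ϱ₀ ϱ φmin φmax pmax old →
        StepBounds o P t old s₀ s₁ (1 / P.β) m H ω := by
  obtain ⟨m, hm, hfm⟩ := exists_f_mu_bound P hϱ₀ hϱ
  obtain ⟨Λ, hΛ, hmob⟩ := exists_mob_bound P hφmin hφmax
  obtain ⟨C, hC, hflux⟩ := exists_flux_sq_le o
  have hRT : 0 < P.R * P.T := mul_pos P.R_pos P.T_pos
  have hβ := P.β_pos
  have h1ϱ : 0 < 1 - ϱ := by linarith
  refine ⟨ϱ₀ / P.β * (1 - ϱ) ^ 2 / (max θmax 1 * (P.R * P.T)), by positivity,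
    1 / P.β / (P.R * P.T), by positivity, max m pmax, hm.trans (le_max_left _ _),
    (1 / P.β) ^ 2 * (C + 1) * Λ, by positivity, Λ, hΛ, ?_⟩
  intro t hθ hθm old hold
  have hθ0 : 0 < t.θ := by linarith
  have hcl : ∀ K, ϱ₀ / P.β ≤ old.c K := fun K =>
    (div_le_iff₀ hβ).2 (by linarith [(hold.density K).1])
  have hcpos : ∀ K, 0 < old.c K := fun K => (div_pos hϱ₀ hβ).trans_le (hcl K)
  have hcu : ∀ K, old.c K ≤ 1 / P.β := fun K =>
    (le_div_iff₀ hβ).2 (by linarith [(hold.density K).2])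
  have h1c : ∀ K, 1 - ϱ ≤ 1 - P.β * old.c K := fun K => by linarith [(hold.density K).2]
  have h1c' : ∀ K, 1 - P.β * old.c K ≤ 1 := fun K => by linarith [mul_pos hβ (hcpos K)]
  have hmobpos : ∀ K, 0 < P.mob (old.phi K) := fun K =>
    mob_pos P (hφmin.trans_le (hold.porosity K).1) ((hold.porosity K).2.trans_lt hφmax)
  have hl2 : ∀ u : P1 M, l2SqV u ≤ Λ * darcyForm P old u u := fun u => by
    rw [l2SqV_eq, l2Form_apply, darcyForm_apply, Finset.mul_sum]
    refine Finset.sum_le_sum fun K _ => ?_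
    have h1 := (hmob _ (hold.porosity K).1 (hold.porosity K).2).1
    have h2 : 1 ≤ Λ * (P.mob (old.phi K))⁻¹ := by
      rw [← div_eq_mul_inv, le_div_iff₀ (hmobpos K)]
      linarith
    rw [← mul_assoc]
    exact le_mul_of_one_le_left (cellForm_nonneg K u) h2
  have hnn : ∀ u : P1 M, 0 ≤ darcyForm P old u u := fun u => by
    rw [darcyForm_apply]
    exact Finset.sum_nonneg fun K _ => mul_nonneg (inv_pos.2 (hmobpos K)).le (cellForm_nonneg K u)
  refine ⟨fun K => ?_, fun K => ?_, hcpos, hcu, fun K => ?_, fun K => ?_, fun K => ?_,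
    fun K x c => ?_, hnn, fun u => ?_, hl2, fun q u => ?_⟩
  · have h1 : 0 < 1 - P.β * old.c K := h1ϱ.trans_le (h1c K)
    have h2 : t.θ ≤ max θmax 1 := hθm.trans (le_max_left _ _)
    have h3 := hcpos K
    have h4 := hcl K
    have h5 := h1c K
    rw [slope, mul_assoc t.θ]
    gcongr
  · have h1 : 0 < 1 - P.β * old.c K := h1ϱ.trans_le (h1c K)
    have h2 : old.c K * (1 - P.β * old.c K) ^ 2 ≤ 1 / P.β * 1 :=
      mul_le_mul (hcu K) (pow_le_one₀ h1.le (h1c' K)) (sq_nonneg _) (by positivity)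
    have h3 : P.R * P.T ≤ t.θ * P.R * P.T := by
      rw [mul_assoc]
      exact le_mul_of_one_le_left hRT.le hθ
    rw [mul_one] at h2
    exact div_le_div₀ (by positivity) h2 hRT h3
  · exact (hfm _ (hold.density K).1 (hold.density K).2).2.trans (le_max_left _ _)
  · exact (hfm _ (hold.density K).1 (hold.density K).2).1.trans (le_max_left _ _)
  · exact (hold.pressure K).trans (le_max_right _ _)
  · have h1 : 1 - P.β * old.c K ≠ 0 := (h1ϱ.trans_le (h1c K)).ne'
    have h2 := (hcpos K).ne'
    have hR := P.R_pos.ne'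
    have hT := P.T_pos.ne'
    have h3 := hθ0.ne'
    rw [slope]
    generalize 1 - P.β * old.c K = y at h1 ⊢
    constructor
    · rintro rfl
      field_simp
      ring
    · rintro rfl
      field_simp
      ring
  · rw [l2SqV_eq, l2Form_apply, darcyForm_apply, Finset.mul_sum]
    refine Finset.sum_le_sum fun K _ => ?_
    exact mul_le_mul_of_nonneg_right (hmob _ (hold.porosity K).1 (hold.porosity K).2).2
      (cellForm_nonneg K u)
  · have hJ := jumpProd_nonneg o q
    have h1 : ∑ e, (upwind o old e * flux o e u) ^ 2 ≤
        (1 / P.β) ^ 2 * ((C + 1) * (Λ * darcyForm P old u u)) := by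
      calc ∑ e, (upwind o old e * flux o e u) ^ 2 ≤ ∑ e, (1 / P.β) ^ 2 * flux o e u ^ 2 := by
            refine Finset.sum_le_sum fun e _ => ?_
            rw [mul_pow]
            exact mul_le_mul_of_nonneg_right (upwind_sq_le o old hcpos hcu e) (sq_nonneg _)
        _ = (1 / P.β) ^ 2 * ∑ e, flux o e u ^ 2 := by rw [Finset.mul_sum]
        _ ≤ (1 / P.β) ^ 2 * ((C + 1) * (Λ * darcyForm P old u u)) := by
            refine mul_le_mul_of_nonneg_left ((hflux u).trans ?_) (sq_nonneg _)
            have h0 : 0 ≤ l2SqV u := by rw [l2SqV_eq]; exact l2Form_nonneg u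
            have := hl2 u
            gcongr
            linarith
    calc convection o old q u ^ 2 ≤
          (∑ e, (upwind o old e * flux o e u) ^ 2) * ∑ e, jumpQ o q e ^ 2 := by
          rw [convection_apply]
          exact Finset.sum_mul_sq_le_sq_mul_sq _ _ _
      _ ≤ (1 / P.β) ^ 2 * ((C + 1) * (Λ * darcyForm P old u u)) * jumpProd o q q := by
          have h2 : ∑ e, jumpQ o q e ^ 2 = jumpProd o q q := by
            simp only [jumpProd_apply, sq]
          rw [h2]
          exact mul_le_mul_of_nonneg_right h1 hJ
      _ = _ := by ring

end Bounds

/-! ### One step of the iteration -/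

section Step

variable {d : ℕ} {Ω : Set (E d)} {M : Triangulation d Ω}

/-- The total volume of the mesh. -/
def totalVol (M : Triangulation d Ω) : ℝ := ∑ K : Elem M, vol K

theorem totalVol_nonneg (M : Triangulation d Ω) : 0 ≤ totalVol M :=
  Finset.sum_nonneg fun K _ => (vol_pos K).le

theorem neg_le_half_add {x a b : ℝ} (ha : 0 ≤ a) (hb : 0 ≤ b) (h : x ^ 2 ≤ a * b) :
    -x ≤ (a + b) / 2 := by
  have h1 : x ^ 2 ≤ ((a + b) / 2) ^ 2 := h.trans (by nlinarith [sq_nonneg (a - b)])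
  exact (neg_le_abs x).trans (abs_le_of_sq_le_sq h1 (by linarith))

theorem l2SqQ_le_of_abs_le {p q : P0 M} {r : ℝ} (h : ∀ K, |p K| ≤ r * |q K|) :
    l2SqQ p ≤ r ^ 2 * l2SqQ q := by
  rw [l2SqQ_eq, l2SqQ_eq, Finset.mul_sum]
  refine Finset.sum_le_sum fun K _ => ?_
  have h1 : p K ^ 2 ≤ r ^ 2 * q K ^ 2 := by
    calc p K ^ 2 = |p K| ^ 2 := (sq_abs _).symm
      _ ≤ (r * |q K|) ^ 2 := pow_le_pow_left₀ (abs_nonneg _) (h K) 2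
      _ = r ^ 2 * q K ^ 2 := by rw [mul_pow, sq_abs]
  calc vol K * p K ^ 2 ≤ vol K * (r ^ 2 * q K ^ 2) := mul_le_mul_of_nonneg_left h1 (vol_pos K).le
    _ = _ := by ring

theorem eq_zero_of_qForm (q : P0 M) : qForm q q = 0 → q = 0 := fun h =>
  eq_zero_of_l2SqQ q (by rw [l2SqQ_eq_qForm, h])

theorem half_sq_sub_le {a s φ b D e : ℝ} (ha : 0 < a) (hs : a ≤ φ * s) (hb : b ^ 2 ≤ D) :
    a / 2 * e ^ 2 - D / (2 * a) ≤ (φ * (s * e) + b) * e := by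
  have h1 : 0 ≤ (a * e + b) ^ 2 / (2 * a) := by positivity
  have h2 : (a * e + b) ^ 2 / (2 * a) = a / 2 * e ^ 2 + b * e + b ^ 2 / (2 * a) := by
    field_simp
    ring
  have h3 : b ^ 2 / (2 * a) ≤ D / (2 * a) := div_le_div_of_nonneg_right hb (by linarith)
  have h4 := mul_le_mul_of_nonneg_right hs (sq_nonneg e)
  nlinarith

variable [NeZero d]

/-- All equations of the scheme except the mass balance.  They determine the level `y` from `y.mu`, up
to a rigid displacement, and do not involve the lagged quantities. -/
structure Constitutive (o : Orientation M) (P : Physical) (t : Tuning) (old y : Level M) :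
    Prop where
  velocity_mem : y.uf ∈ RT0 M
  density : ∀ K, y.c K = old.c K + slope P t old K * (y.mu K - P.mu (old.c K))
  momentum : ∀ v, formA o P t y.us y.p v = 0
  darcy : ∀ w ∈ RT0 M, darcyForm P old y.uf w = convection o old y.mu w
  pressure : ∀ K, y.p K = old.c K * y.mu K - P.f (old.c K)
  porosity : ∀ r, qForm (y.phi - old.phi) r =
    1 / t.N * qForm (y.p - old.p) r + P.α * coupling o (y.us - old.us) r

/-- The mass balance for the level `new`, with porosity and velocity taken from `lag`. -/
def MassBalance (o : Orientation M) (t : Tuning) (old lag new : Level M) : Prop :=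
  ∀ q, qForm (lag.phi * new.c - old.phi * old.c) q +
    t.τ * (convection o old q lag.uf + t.ς₁ * jumpProd o new.mu q) = 0

/-- The constants of the analysis: those of `StepBounds`, the constant `C` of `ElasticBounds`, a lower
bound `φ₀` for the lagged porosity, the radius `Cε` of the porosity ball, a bound `Y` for
`τ (λ⁻¹ u_f, u_f)` along the iteration and a lower bound `v` for the volumes of the elements. -/
structure Constants where
  s₀ : ℝ
  s₁ : ℝ
  c₁ : ℝ
  m : ℝ
  H : ℝ
  ω : ℝ
  C : ℝ
  φ₀ : ℝ
  Cε : ℝ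
  Y : ℝ
  v : ℝ

/-- Coercivity constant of the accumulation term. -/
def Constants.a (k : Constants) : ℝ := k.φ₀ * k.s₀

/-- Contribution of the previous level to the energy estimate, per unit volume. -/
def Constants.D (k : Constants) : ℝ := (k.s₁ * k.m + k.c₁) ^ 2 / (2 * k.a)

/-- Bound for `‖μ‖²` along the iteration on a mesh of total volume `V`. -/
def Constants.muBound (k : Constants) (V : ℝ) : ℝ := 2 / k.a * (V * k.D + k.Y / 2)

/-- Bound for `‖p - pⁿ‖²` along the iteration. -/
def Constants.pBound (k : Constants) (V : ℝ) : ℝ :=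
  3 * (k.c₁ ^ 2 * k.muBound V + V * (2 * k.m ^ 2))

/-- Pointwise bound for the density along the iteration. -/
def Constants.cBound (k : Constants) (V : ℝ) : ℝ :=
  k.c₁ + k.s₁ * (Real.sqrt (k.muBound V / k.v) + k.m)

/-- The smallness and positivity assumptions under which one step of the iteration preserves the
porosity ball and is a contraction.  The factor `1 / N + C / γ` bounds the response of the porosity to
the pressure. -/
structure Regime (o : Orientation M) (P : Physical) (t : Tuning) (old : Level M)
    (k : Constants) : Prop where
  step : StepBounds o P t old k.s₀ k.s₁ k.c₁ k.m k.H k.ω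
  elastic : ElasticBounds o P t k.C
  momentum : ∀ v, formA o P t old.us old.p v = 0
  phi_lower : ∀ K, k.φ₀ + k.Cε ≤ old.phi K
  phi_upper : ∀ K, old.phi K + k.Cε ≤ 1
  v_le : ∀ K : Elem M, k.v ≤ vol K
  s₀_pos : 0 < k.s₀
  s₁_pos : 0 < k.s₁
  H_pos : 0 < k.H
  ω_pos : 0 < k.ω
  C_nonneg : 0 ≤ k.C
  φ₀_pos : 0 < k.φ₀
  Cε_pos : 0 < k.Cε
  v_pos : 0 < k.v
  τ_pos : 0 < t.τ
  γ_pos : 0 < t.γ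
  N_pos : 0 < t.N
  ς_ge : 2 * k.H ≤ t.ς₁
  Y_ge : totalVol M * k.D ≤ k.Y
  small_porosity : (1 / t.N + k.C / t.γ) ^ 2 * k.pBound (totalVol M) ≤ k.v * k.Cε ^ 2
  small_contraction : (1 / t.N + k.C / t.γ) ^ 2 *
    (k.c₁ ^ 2 * k.cBound (totalVol M) ^ 2 / (2 * k.a)) ≤ k.a / 4

theorem StepBounds.equations_iff {o : Orientation M} {P : Physical} {t : Tuning} {old : Level M}
    {s₀ s₁ c₁ m H ω : ℝ} (B : StepBounds o P t old s₀ s₁ c₁ m H ω) (hτ : 0 < t.τ)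
    (lag new : Level M) :
    Equations o P t old lag new ↔ Constitutive o P t old new ∧ MassBalance o t old lag new := by
  rw [PoroGas.equations_iff o P t old lag new hτ.ne']
  constructor
  · rintro ⟨h1, h2, h3, h4, h5, h6, h7⟩
    exact ⟨⟨h1, fun K => (B.potential_iff K _ _).1 (h2 K), h3, h5, h6, h7⟩, h4⟩
  · rintro ⟨⟨h1, h2, h3, h5, h6, h7⟩, h4⟩
    exact ⟨h1, fun K => (B.potential_iff K _ _).2 (h2 K), h3, h4, h5, h6, h7⟩

variable {o : Orientation M} {P : Physical} {t : Tuning} {old : Level M} {k : Constants}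

theorem formA_sub (u u' : P1 M) (p p' : P0 M) (v : P1 M) :
    formA o P t (u - u') (p - p') v = formA o P t u p v - formA o P t u' p' v := by
  simp only [formA_eq, map_sub, LinearMap.sub_apply]
  ring

/-- The porosity responds to the pressure with the small factor `1 / N + C / γ`. -/
theorem Regime.porosity_le (R : Regime o P t old k) {u u' : P1 M} {p p' ψ : P0 M}
    (hu : ∀ v, formA o P t u p v = 0) (hu' : ∀ v, formA o P t u' p' v = 0)
    (hψ : ∀ r, qForm ψ r = 1 / t.N * qForm (p - p') r + P.α * coupling o (u - u') r) :
    l2SqQ ψ ≤ (1 / t.N + k.C / t.γ) ^ 2 * l2SqQ (p - p') := by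
  have h1 := R.elastic.coupling_le (u - u') (p - p')
    (fun v => by rw [formA_sub, hu, hu', sub_zero]) ψ
  have h2 := hψ ψ
  rw [← l2SqQ_eq_qForm] at h2
  have h3 := qForm_sq_le (p - p') ψ
  set S := l2SqQ ψ
  set Q := l2SqQ (p - p')
  have hS : 0 ≤ S := l2SqQ_nonneg ψ
  have hQ : 0 ≤ Q := l2SqQ_nonneg _
  have hN : 0 < 1 / t.N := one_div_pos.2 R.N_pos
  have hC : 0 ≤ k.C / t.γ := div_nonneg R.C_nonneg R.γ_pos.le
  have h4 : |qForm (p - p') ψ| ≤ Real.sqrt (Q * S) := Real.abs_le_sqrt h3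
  have h5 : |P.α * coupling o (u - u') ψ| ≤ k.C / t.γ * Real.sqrt (Q * S) := by
    refine abs_le_of_sq_le_sq ?_ (by positivity)
    rw [mul_pow (k.C / t.γ), Real.sq_sqrt (by positivity)]
    linarith
  have h6 : S ≤ (1 / t.N + k.C / t.γ) * Real.sqrt (Q * S) := by
    have h7 := mul_le_mul_of_nonneg_left ((le_abs_self _).trans h4) hN.le
    have h8 := (le_abs_self _).trans h5
    rw [add_mul]
    linarith
  have h9 : S ^ 2 ≤ (1 / t.N + k.C / t.γ) ^ 2 * (Q * S) := by
    calc S ^ 2 ≤ ((1 / t.N + k.C / t.γ) * Real.sqrt (Q * S)) ^ 2 := pow_le_pow_left₀ hS h6 2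
      _ = _ := by rw [mul_pow, Real.sq_sqrt (by positivity)]
  rcases hS.eq_or_lt with h | h
  · rw [← h]
    positivity
  · refine le_of_mul_le_mul_right ?_ h
    linarith

theorem Constitutive.porosity_sub {x y : Level M} (hx : Constitutive o P t old x)
    (hy : Constitutive o P t old y) (r : P0 M) : qForm (x.phi - y.phi) r =
      1 / t.N * qForm (x.p - y.p) r + P.α * coupling o (x.us - y.us) r := by
  have h1 := hx.porosity r
  have h2 := hy.porosity r
  simp only [map_sub, LinearMap.sub_apply] at h1 h2 ⊢
  linarith

theorem Regime.abs_density (R : Regime o P t old k) (K : Elem M) : |old.c K| ≤ k.c₁ := by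
  rw [abs_of_pos (R.step.density_pos K)]
  exact R.step.density K

theorem Regime.slope_pos (R : Regime o P t old k) (K : Elem M) : 0 < slope P t old K :=
  R.s₀_pos.trans_le (R.step.slope_lower K)

theorem Regime.a_pos (R : Regime o P t old k) : 0 < k.a := mul_pos R.φ₀_pos R.s₀_pos

theorem Regime.pressure_sub_le (R : Regime o P t old k) {x y : Level M}
    (hx : Constitutive o P t old x) (hy : Constitutive o P t old y) :
    l2SqQ (x.p - y.p) ≤ k.c₁ ^ 2 * l2SqQ (x.mu - y.mu) := by
  refine l2SqQ_le_of_abs_le fun K => ?_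
  have : (x.p - y.p) K = old.c K * (x.mu - y.mu) K := by
    simp only [Pi.sub_apply, hx.pressure, hy.pressure]
    ring
  rw [this, abs_mul]
  exact mul_le_mul_of_nonneg_right (R.abs_density K) (abs_nonneg _)

theorem Regime.density_sub_le (R : Regime o P t old k) {x y : Level M}
    (hx : Constitutive o P t old x) (hy : Constitutive o P t old y) :
    l2SqQ (x.c - y.c) ≤ k.s₁ ^ 2 * l2SqQ (x.mu - y.mu) := by
  refine l2SqQ_le_of_abs_le fun K => ?_
  have : (x.c - y.c) K = slope P t old K * (x.mu - y.mu) K := by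
    simp only [Pi.sub_apply, hx.density, hy.density]
    ring
  rw [this, abs_mul, abs_of_pos (R.slope_pos K)]
  exact mul_le_mul_of_nonneg_right (R.step.slope_upper K) (abs_nonneg _)

theorem Regime.porosity_sub_le (R : Regime o P t old k) {x y : Level M}
    (hx : Constitutive o P t old x) (hy : Constitutive o P t old y) :
    l2SqQ (x.phi - y.phi) ≤
      (1 / t.N + k.C / t.γ) ^ 2 * (k.c₁ ^ 2 * l2SqQ (x.mu - y.mu)) :=
  (R.porosity_le hx.momentum hy.momentum (hx.porosity_sub hy)).trans
    (mul_le_mul_of_nonneg_left (R.pressure_sub_le hx hy) (sq_nonneg _))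

/-- Darcy's law bounds the velocity by the jumps of the potential. -/
theorem Regime.darcy_le_jump (R : Regime o P t old k) {μ : P0 M} {u : P1 M}
    (h : darcyForm P old u u = convection o old μ u) :
    darcyForm P old u u ≤ k.H * jumpProd o μ μ := by
  have h1 := R.step.convection_sq_le μ u
  have h2 := R.step.darcy_nonneg u
  rw [← h] at h1
  rcases h2.eq_or_lt with h0 | h0
  · rw [← h0]
    exact mul_nonneg R.H_pos.le (jumpProd_nonneg o μ)
  · exact le_of_mul_le_mul_right (by linarith [sq (darcyForm P old u u)]) h0

theorem Constitutive.darcy_sub {x y : Level M} (hx : Constitutive o P t old x)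
    (hy : Constitutive o P t old y) :
    darcyForm P old (x.uf - y.uf) (x.uf - y.uf) =
      convection o old (x.mu - y.mu) (x.uf - y.uf) := by
  have hm := (RT0 M).sub_mem hx.velocity_mem hy.velocity_mem
  have h1 := hx.darcy _ hm
  have h2 := hy.darcy _ hm
  rw [map_sub (darcyForm P old), LinearMap.sub_apply, h1, h2, map_sub (convection o old),
    LinearMap.sub_apply]

/-- The energy estimate: test the mass balance with the potential.  The convection term, whose velocity
`u` is lagged, is absorbed by the interior penalty because `2 H ≤ ς₁`. -/
theorem Regime.energy (R : Regime o P t old k) {g μ : P0 M} {u u' : P1 M} {r : Elem M → ℝ}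
    (hmass : qForm g μ + t.τ * (convection o old μ u + t.ς₁ * jumpProd o μ μ) = 0)
    (hdarcy : darcyForm P old u' u' = convection o old μ u')
    (hg : ∀ K, k.a / 2 * μ K ^ 2 - r K ≤ g K * μ K) :
    k.a / 2 * l2SqQ μ + 3 / 2 * (t.τ * darcyForm P old u' u') ≤
      ∑ K, vol K * r K + t.τ * darcyForm P old u u / 2 := by
  have h1 : k.a / 2 * l2SqQ μ - ∑ K, vol K * r K ≤ qForm g μ := by
    rw [l2SqQ_eq, qForm_apply, Finset.mul_sum, ← Finset.sum_sub_distrib]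
    refine Finset.sum_le_sum fun K _ => ?_
    have := mul_le_mul_of_nonneg_left (hg K) (vol_pos K).le
    linarith
  have hJ := jumpProd_nonneg o μ
  have h2 := neg_le_half_add (mul_nonneg R.H_pos.le hJ) (R.step.darcy_nonneg u)
    (R.step.convection_sq_le μ u)
  have h3 := R.darcy_le_jump hdarcy
  have h4 := mul_le_mul_of_nonneg_right R.ς_ge hJ
  have h5 : 3 / 2 * darcyForm P old u' u' - darcyForm P old u u / 2 ≤
      convection o old μ u + t.ς₁ * jumpProd o μ μ := by linarith
  have h6 := mul_le_mul_of_nonneg_left h5 R.τ_pos.le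
  linarith

/-- A priori estimate for one step whose lagged porosity lies in the ball around `φⁿ`. -/
theorem Regime.apriori (R : Regime o P t old k) {lag new : Level M}
    (hlag : ∀ K, |lag.phi K - old.phi K| ≤ k.Cε) (hc : Constitutive o P t old new)
    (hm : MassBalance o t old lag new) :
    k.a / 2 * l2SqQ new.mu + 3 / 2 * (t.τ * darcyForm P old new.uf new.uf) ≤
      totalVol M * k.D + t.τ * darcyForm P old lag.uf lag.uf / 2 := by
  have h := R.energy (hm new.mu) (hc.darcy _ hc.velocity_mem) (r := fun _ => k.D) (fun K => by
    have hl := abs_le.1 (hlag K)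
    have hφ₀ : k.φ₀ ≤ lag.phi K := by linarith [R.phi_lower K]
    have hφ₁ : lag.phi K ≤ 1 := by linarith [R.phi_upper K]
    have hCε : k.Cε ≤ 1 := by linarith [R.phi_lower K, R.phi_upper K, R.φ₀_pos, R.Cε_pos]
    have hs := R.slope_pos K
    have ha : k.a ≤ lag.phi K * slope P t old K :=
      mul_le_mul hφ₀ (R.step.slope_lower K) R.s₀_pos.le (R.φ₀_pos.le.trans hφ₀)
    have hb : (-(lag.phi K * slope P t old K * P.mu (old.c K)) +
        (lag.phi K - old.phi K) * old.c K) ^ 2 ≤ (k.s₁ * k.m + k.c₁) ^ 2 := by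
      refine sq_le_sq' ?_ ?_ <;>
      · have h1 : |lag.phi K * slope P t old K * P.mu (old.c K)| ≤ k.s₁ * k.m := by
          rw [abs_mul, abs_of_pos (mul_pos (R.φ₀_pos.trans_le hφ₀) hs)]
          refine mul_le_mul ?_ (R.step.potential K) (abs_nonneg _) R.s₁_pos.le
          exact (mul_le_of_le_one_left hs.le hφ₁).trans (R.step.slope_upper K)
        have h2 : |(lag.phi K - old.phi K) * old.c K| ≤ k.c₁ := by
          rw [abs_mul]
          exact (mul_le_of_le_one_left (abs_nonneg _) ((hlag K).trans hCε)).trans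
            (R.abs_density K)
        have h3 := abs_le.1 h1
        have h4 := abs_le.1 h2
        linarith
    have := half_sq_sub_le (e := new.mu K) R.a_pos ha hb
    have hg : (lag.phi * new.c - old.phi * old.c) K =
        lag.phi K * (slope P t old K * new.mu K) +
        (-(lag.phi K * slope P t old K * P.mu (old.c K)) +
        (lag.phi K - old.phi K) * old.c K) := by
      simp only [Pi.sub_apply, Pi.mul_apply, hc.density]
      ring
    rw [hg]
    exact this)
  rwa [← Finset.sum_mul] at h

/-- Stability of one step.  Only the porosity lagged in the first step and the density of the second
level enter, so that the estimate also serves for uniqueness. -/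
theorem Regime.stability (R : Regime o P t old k) {x x' y y' : Level M}
    (hφ : ∀ K, k.φ₀ ≤ x.phi K) (hc : ∀ K, |y'.c K| ≤ k.cBound (totalVol M))
    (hx : Constitutive o P t old x) (hy : Constitutive o P t old y)
    (hx' : Constitutive o P t old x') (hy' : Constitutive o P t old y')
    (hmx : MassBalance o t old x x') (hmy : MassBalance o t old y y') :
    k.a / 2 * l2SqQ (x'.mu - y'.mu) +
        3 / 2 * (t.τ * darcyForm P old (x'.uf - y'.uf) (x'.uf - y'.uf)) ≤
      1 / 2 * (k.a / 2 * l2SqQ (x.mu - y.mu) +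
        3 / 2 * (t.τ * darcyForm P old (x.uf - y.uf) (x.uf - y.uf))) := by
  set B := k.cBound (totalVol M)
  have hmass : qForm (x.phi * x'.c - y.phi * y'.c) (x'.mu - y'.mu) +
      t.τ * (convection o old (x'.mu - y'.mu) (x.uf - y.uf) +
        t.ς₁ * jumpProd o (x'.mu - y'.mu) (x'.mu - y'.mu)) = 0 := by
    have h1 := hmx (x'.mu - y'.mu)
    have h2 := hmy (x'.mu - y'.mu)
    have e1 : x.phi * x'.c - y.phi * y'.c =
        (x.phi * x'.c - old.phi * old.c) - (y.phi * y'.c - old.phi * old.c) := by abel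
    rw [e1, map_sub qForm, LinearMap.sub_apply, map_sub (convection o old _),
      map_sub (jumpProd o), LinearMap.sub_apply]
    linarith
  have h := R.energy hmass (hx'.darcy_sub hy')
    (r := fun K => B ^ 2 * (x.phi - y.phi) K ^ 2 / (2 * k.a)) (fun K => by
      have ha : k.a ≤ x.phi K * slope P t old K :=
        mul_le_mul (hφ K) (R.step.slope_lower K) R.s₀_pos.le (R.φ₀_pos.le.trans (hφ K))
      have hb : (y'.c K * (x.phi - y.phi) K) ^ 2 ≤ B ^ 2 * (x.phi - y.phi) K ^ 2 := by
        rw [mul_pow]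
        refine mul_le_mul_of_nonneg_right ?_ (sq_nonneg _)
        rw [← sq_abs]
        exact pow_le_pow_left₀ (abs_nonneg _) (hc K) 2
      have := half_sq_sub_le (e := (x'.mu - y'.mu) K) R.a_pos ha hb
      have hg : (x.phi * x'.c - y.phi * y'.c) K =
          x.phi K * (slope P t old K * (x'.mu - y'.mu) K) + y'.c K * (x.phi - y.phi) K := by
        simp only [Pi.sub_apply, Pi.mul_apply, hx'.density, hy'.density]
        ring
      rw [hg]
      exact this)
  have h2 : ∑ K, vol K * (B ^ 2 * (x.phi - y.phi) K ^ 2 / (2 * k.a)) =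
      B ^ 2 / (2 * k.a) * l2SqQ (x.phi - y.phi) := by
    rw [l2SqQ_eq, Finset.mul_sum]
    exact Finset.sum_congr rfl fun K _ => by ring
  have hm := l2SqQ_nonneg (x.mu - y.mu)
  have h3 : B ^ 2 / (2 * k.a) * l2SqQ (x.phi - y.phi) ≤ k.a / 4 * l2SqQ (x.mu - y.mu) := by
    have ha := R.a_pos
    calc B ^ 2 / (2 * k.a) * l2SqQ (x.phi - y.phi) ≤ B ^ 2 / (2 * k.a) *
          ((1 / t.N + k.C / t.γ) ^ 2 * (k.c₁ ^ 2 * l2SqQ (x.mu - y.mu))) :=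
          mul_le_mul_of_nonneg_left (R.porosity_sub_le hx hy) (by positivity)
      _ = (1 / t.N + k.C / t.γ) ^ 2 * (k.c₁ ^ 2 * B ^ 2 / (2 * k.a)) *
          l2SqQ (x.mu - y.mu) := by ring
      _ ≤ k.a / 4 * l2SqQ (x.mu - y.mu) :=
          mul_le_mul_of_nonneg_right R.small_contraction hm
  have h4 := mul_nonneg R.τ_pos.le (R.step.darcy_nonneg (x.uf - y.uf))
  linarith

/-- The set of levels preserved by the iteration. -/
structure Admissible (o : Orientation M) (P : Physical) (t : Tuning) (old : Level M) (k : Constants)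
    (x : Level M) : Prop where
  phi : ∀ K, |x.phi K - old.phi K| ≤ k.Cε
  energy : t.τ * darcyForm P old x.uf x.uf ≤ k.Y

theorem Regime.density_le (R : Regime o P t old k) {x : Level M} (hc : Constitutive o P t old x)
    (h : l2SqQ x.mu ≤ k.muBound (totalVol M)) (K : Elem M) :
    |x.c K| ≤ k.cBound (totalVol M) := by
  have h1 : |x.mu K| ≤ Real.sqrt (k.muBound (totalVol M) / k.v) := by
    refine Real.abs_le_sqrt ?_
    rw [le_div_iff₀ R.v_pos, mul_comm]
    exact (mul_le_mul_of_nonneg_right (R.v_le K) (sq_nonneg _)).trans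
      ((mul_sq_le_l2SqQ x.mu K).trans h)
  rw [hc.density]
  have h2 : |x.mu K - P.mu (old.c K)| ≤ Real.sqrt (k.muBound (totalVol M) / k.v) + k.m :=
    (abs_sub _ _).trans (add_le_add h1 (R.step.potential K))
  calc |old.c K + slope P t old K * (x.mu K - P.mu (old.c K))|
      ≤ |old.c K| + |slope P t old K * (x.mu K - P.mu (old.c K))| := abs_add_le _ _
    _ ≤ k.c₁ + k.s₁ * (Real.sqrt (k.muBound (totalVol M) / k.v) + k.m) := by
        rw [abs_mul, abs_of_pos (R.slope_pos K)]
        exact add_le_add (R.abs_density K)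
          (mul_le_mul (R.step.slope_upper K) h2 (abs_nonneg _) R.s₁_pos.le)

/-- One step of the iteration preserves admissibility and bounds the new potential. -/
theorem Regime.admissible_next (R : Regime o P t old k) {lag new : Level M}
    (hlag : Admissible o P t old k lag) (hc : Constitutive o P t old new)
    (hm : MassBalance o t old lag new) :
    Admissible o P t old k new ∧ l2SqQ new.mu ≤ k.muBound (totalVol M) := by
  have ha := R.a_pos
  have h1 := R.apriori hlag.phi hc hm
  have h2 := hlag.energy
  have h3 := mul_nonneg R.τ_pos.le (R.step.darcy_nonneg new.uf)
  have h4 := l2SqQ_nonneg new.mu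
  have h5 := R.Y_ge
  have hmu : l2SqQ new.mu ≤ k.muBound (totalVol M) := by
    have e : l2SqQ new.mu = 2 / k.a * (k.a / 2 * l2SqQ new.mu) := by
      field_simp
    rw [e, Constants.muBound]
    refine mul_le_mul_of_nonneg_left ?_ (by positivity)
    linarith
  refine ⟨⟨fun K => ?_, ?_⟩, hmu⟩
  · have h6 := R.porosity_le hc.momentum R.momentum hc.porosity
    have h7 : l2SqQ (new.p - old.p) ≤ k.pBound (totalVol M) := by
      have e : k.pBound (totalVol M) = 3 * (k.c₁ ^ 2 * k.muBound (totalVol M)) +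
          ∑ K : Elem M, vol K * (6 * k.m ^ 2) := by
        rw [← Finset.sum_mul, Constants.pBound, totalVol]
        ring
      rw [e]
      refine le_trans ?_ (add_le_add_left (mul_le_mul_of_nonneg_left
        (mul_le_mul_of_nonneg_left hmu (sq_nonneg k.c₁)) (by norm_num : (0 : ℝ) ≤ 3)) _)
      rw [l2SqQ_eq, l2SqQ_eq, Finset.mul_sum, Finset.mul_sum, ← Finset.sum_add_distrib]
      refine Finset.sum_le_sum fun K _ => ?_
      have hc1 : (old.c K * new.mu K) ^ 2 ≤ k.c₁ ^ 2 * new.mu K ^ 2 := by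
        rw [mul_pow]
        exact mul_le_mul_of_nonneg_right
          (pow_le_pow_left₀ (R.step.density_pos K).le (R.step.density K) 2) (sq_nonneg _)
      have hf : P.f (old.c K) ^ 2 ≤ k.m ^ 2 := by
        rw [← sq_abs]
        exact pow_le_pow_left₀ (abs_nonneg _) (R.step.energy K) 2
      have hp : old.p K ^ 2 ≤ k.m ^ 2 := by
        rw [← sq_abs]
        exact pow_le_pow_left₀ (abs_nonneg _) (R.step.pressure K) 2
      have h8 : (new.p - old.p) K ^ 2 ≤ 3 * (k.c₁ ^ 2 * new.mu K ^ 2) + 6 * k.m ^ 2 := by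
        rw [Pi.sub_apply, hc.pressure]
        nlinarith [sq_nonneg (old.c K * new.mu K + P.f (old.c K)),
          sq_nonneg (old.c K * new.mu K + old.p K), sq_nonneg (P.f (old.c K) - old.p K)]
      have := mul_le_mul_of_nonneg_left h8 (vol_pos K).le
      linarith
    have h8 := mul_sq_le_l2SqQ (new.phi - old.phi) K
    have h9 := mul_le_mul_of_nonneg_right (R.v_le K) (sq_nonneg ((new.phi - old.phi) K))
    have h10 : k.v * (new.phi - old.phi) K ^ 2 ≤ k.v * k.Cε ^ 2 :=
      h9.trans (h8.trans (h6.trans ((mul_le_mul_of_nonneg_left h7 (sq_nonneg _)).trans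
        R.small_porosity)))
    exact abs_le_of_sq_le_sq (le_of_mul_le_mul_left h10 R.v_pos) R.Cε_pos.le
  · have : 0 ≤ k.a / 2 * l2SqQ new.mu := by positivity
    linarith

/-- Every potential is the potential of a level that satisfies the constitutive equations. -/
theorem Regime.exists_constitutive (R : Regime o P t old k) (μ : P0 M) :
    ∃ y : Level M, y.mu = μ ∧ Constitutive o P t old y := by
  set p : P0 M := fun K => old.c K * μ K - P.f (old.c K) with hp
  obtain ⟨u, hu⟩ := R.elastic.exists_displacement p
  obtain ⟨ψ, hψ⟩ := exists_form_eq (qForm (M := M)) qForm_comm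
    ((1 / t.N) • qForm (p - old.p) + P.α • coupling o (u - old.us))
    (fun q hq => by rw [eq_zero_of_qForm q hq, map_zero])
  obtain ⟨w, hw⟩ := exists_form_eq ((darcyForm P old).restrict (RT0 M))
    (fun x y => darcyForm_comm P old x y) (convection o old μ ∘ₗ (RT0 M).subtype)
    (fun x hx => by
      have h1 : darcyForm P old (x : P1 M) x = 0 := hx
      have h2 := R.step.le_darcy x
      rw [h1, mul_zero, l2SqV_eq] at h2
      have h3 := eq_zero_of_l2Form _ (le_antisymm h2 (l2Form_nonneg _))
      simp [h3])
  refine ⟨⟨u, p, w, fun K => old.c K + slope P t old K * (μ K - P.mu (old.c K)), μ,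
    ψ + old.phi⟩, rfl, w.2, fun K => rfl, hu, fun v hv => hw ⟨v, hv⟩, fun K => rfl, fun r => ?_⟩
  have := hψ r
  simp only [add_sub_cancel_right]
  exact this

/-- Each linear step is solvable. -/
theorem Regime.exists_step (R : Regime o P t old k) (lag : Level M)
    (hlag : ∀ K, |lag.phi K - old.phi K| ≤ k.Cε) :
    ∃ new, Equations o P t old lag new := by
  have hφ : ∀ K, 0 < lag.phi K := fun K => by
    have := abs_le.1 (hlag K)
    linarith [R.phi_lower K, R.φ₀_pos]
  -- Solve for the potential: eliminating the density leaves a symmetric positive definite problem.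
  let wt : P0 M →ₗ[ℝ] P0 M := LinearMap.mulLeft ℝ (lag.phi * slope P t old)
  have hwt : ∀ q K, wt q K = lag.phi K * slope P t old K * q K := fun q K => rfl
  let B : LinearMap.BilinForm ℝ (P0 M) := qForm ∘ₗ wt + (t.τ * t.ς₁) • jumpProd o
  have hB : ∀ p q, B p q = qForm (wt p) q + t.τ * t.ς₁ * jumpProd o p q := fun p q => rfl
  have hς : 0 ≤ t.τ * t.ς₁ := mul_nonneg R.τ_pos.le (by linarith [R.ς_ge, R.H_pos])
  obtain ⟨μ, hμ⟩ := exists_form_eq B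
    (fun p q => by
      rw [hB, hB, jumpProd_comm o p q, qForm_apply, qForm_apply]
      congr 1
      exact Finset.sum_congr rfl fun K _ => by rw [hwt, hwt]; ring)
    (-(qForm (lag.phi * (fun K => old.c K - slope P t old K * P.mu (old.c K)) - old.phi * old.c) +
      t.τ • (convection o old).flip lag.uf))
    (fun q hq => by
      have h0 : ∀ K, 0 ≤ vol K * (wt q K * q K) := fun K => by
        rw [hwt, mul_assoc, ← sq]
        have h1 := vol_pos K
        have h2 := hφ K
        have h3 := R.slope_pos K
        positivity
      have h1 : 0 ≤ qForm (wt q) q := Finset.sum_nonneg fun K _ => h0 K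
      have h2 : 0 ≤ t.τ * t.ς₁ * jumpProd o q q := mul_nonneg hς (jumpProd_nonneg o q)
      rw [hB] at hq
      have h3 : qForm (wt q) q = 0 := by linarith
      have hq0 : q = 0 := by
        funext K
        have h4 := (Finset.sum_eq_zero_iff_of_nonneg fun K _ => h0 K).1 h3 K (Finset.mem_univ K)
        rw [hwt] at h4
        simpa [(vol_pos K).ne', (hφ K).ne', (R.slope_pos K).ne'] using h4
      rw [hq0, map_zero])
  obtain ⟨y, hy, hc⟩ := R.exists_constitutive μ
  refine ⟨y, (R.step.equations_iff R.τ_pos lag y).2 ⟨hc, fun q => ?_⟩⟩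
  have h1 := hμ q
  rw [hB] at h1
  have h2 : qForm (lag.phi * y.c - old.phi * old.c) q = qForm (wt μ) q +
      qForm (lag.phi * (fun K => old.c K - slope P t old K * P.mu (old.c K)) -
        old.phi * old.c) q := by
    rw [← LinearMap.add_apply, ← map_add]
    congr 2
    funext K
    simp only [Pi.sub_apply, Pi.mul_apply, Pi.add_apply, hc.density, hwt, hy]
    ring
  simp only [LinearMap.neg_apply, LinearMap.add_apply, LinearMap.smul_apply, LinearMap.flip_apply,
    smul_eq_mul] at h1
  rw [h2, hy]
  linarith

end Step

/-! ### Convergence of the iteration -/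

section Limit

variable {d : ℕ} {Ω : Set (E d)} {M : Triangulation d Ω}

theorem tendsto_l2SqQ {q : ℕ → P0 M} (h : ∀ K, Tendsto (fun l => q l K) atTop (𝓝 0)) :
    Tendsto (fun l => l2SqQ (q l)) atTop (𝓝 0) := by
  simp only [l2SqQ_eq]
  have := tendsto_finsetSum (Finset.univ : Finset (Elem M)) fun K _ =>
    ((h K).pow 2).const_mul (vol K)
  simpa using this

theorem tendsto_of_sq_le {f g : ℕ → ℝ} {r : ℝ} (h : ∀ l, f l ^ 2 ≤ r * g l)
    (hg : Tendsto g atTop (𝓝 0)) : Tendsto f atTop (𝓝 0) := by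
  have h1 : Tendsto (fun l => f l ^ 2) atTop (𝓝 0) :=
    squeeze_zero (fun l => sq_nonneg _) h (by simpa using hg.const_mul r)
  have h2 : Tendsto (fun l => |f l|) atTop (𝓝 0) := by
    have := (Real.continuous_sqrt.tendsto 0).comp h1
    simpa [Function.comp_def, Real.sqrt_sq_eq_abs] using this
  exact (tendsto_zero_iff_abs_tendsto_zero f).2 h2

theorem tendsto_apply_of_l2SqQ {q : ℕ → P0 M} (h : Tendsto (fun l => l2SqQ (q l)) atTop (𝓝 0))
    (K : Elem M) : Tendsto (fun l => q l K) atTop (𝓝 0) := by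
  refine tendsto_of_sq_le (r := (vol K)⁻¹) (fun l => ?_) h
  rw [inv_mul_eq_div, le_div_iff₀ (vol_pos K), mul_comm]
  exact mul_sq_le_l2SqQ (q l) K

theorem tendsto_jumpProd (o : Orientation M) {q : ℕ → P0 M}
    (h : ∀ K, Tendsto (fun l => q l K) atTop (𝓝 0)) :
    Tendsto (fun l => jumpProd o (q l) (q l)) atTop (𝓝 0) := by
  simp only [jumpProd_apply, jumpQ]
  have := tendsto_finsetSum (Finset.univ : Finset (IFace M)) fun e _ =>
    ((h (o.fst e)).sub (h (o.snd e))).mul ((h (o.fst e)).sub (h (o.snd e)))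
  simpa using this

theorem isRigid_zero (o : Orientation M) : IsRigid o (0 : P1 M) := by
  refine ⟨fun K => ?_, fun e x _ => by simp [jumpV]⟩
  have := strain_smul (0 : ℝ) ((0 : P1 M) K)
  simpa using this

/-- The first level of a sequence does not affect its convergence. -/
theorem ConvergesTo.of_succ {o : Orientation M} {x : ℕ → Level M} {y : Level M}
    (h : ConvergesTo o (fun l => x (l + 1)) y) : ConvergesTo o x y := by
  obtain ⟨r, hr, hu⟩ := h.us
  refine ⟨⟨fun l => Nat.casesOn l 0 r, fun l => ?_, ?_⟩, ?_, ?_, ?_, ?_, ?_⟩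
  · cases l with
    | zero => exact isRigid_zero o
    | succ l => exact hr l
  · exact (tendsto_add_atTop_iff_nat 1).1 hu
  · exact (tendsto_add_atTop_iff_nat 1).1 h.uf
  · exact (tendsto_add_atTop_iff_nat 1).1 h.p
  · exact (tendsto_add_atTop_iff_nat 1).1 h.c
  · exact (tendsto_add_atTop_iff_nat 1).1 h.mu
  · exact (tendsto_add_atTop_iff_nat 1).1 h.phi

/-- The squared distance in which the iteration contracts. -/
def energyDist (P : Physical) (t : Tuning) (old : Level M) (k : Constants) (x y : Level M) : ℝ :=
  k.a / 2 * l2SqQ (x.mu - y.mu) + 3 / 2 * (t.τ * darcyForm P old (x.uf - y.uf) (x.uf - y.uf))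

theorem energyDist_comm (P : Physical) (t : Tuning) (old : Level M) (k : Constants)
    (x y : Level M) :
    energyDist P t old k x y = energyDist P t old k y x := by
  rw [energyDist, energyDist, ← neg_sub x.mu, ← neg_sub x.uf, l2SqQ_eq_qForm, l2SqQ_eq_qForm]
  simp only [map_neg, LinearMap.neg_apply, neg_neg]

variable [NeZero d]
variable {o : Orientation M} {P : Physical} {t : Tuning} {old : Level M} {k : Constants}

/-- The displacements follow the pressures modulo rigid displacements: subtract the combination of
the responses to the indicator functions of the elements. -/
theorem ElasticBounds.tendsto_displacement {C : ℝ} (B : ElasticBounds o P t C) {x : ℕ → Level M}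
    {y : Level M} (hx : ∀ l v, formA o P t (x l).us (x l).p v = 0)
    (hy : ∀ v, formA o P t y.us y.p v = 0)
    (hp : ∀ K, Tendsto (fun l => ((x l).p - y.p) K) atTop (𝓝 0)) :
    ∃ r : ℕ → P1 M, (∀ l, IsRigid o (r l)) ∧
      Tendsto (fun l => l2SqV ((x l).us - r l - y.us)) atTop (𝓝 0) := by
  classical
  choose U hU using fun K : Elem M => B.exists_displacement (Pi.single K 1)
  let w : ℕ → P1 M := fun l => ∑ K, ((x l).p - y.p) K • U K
  have hw : ∀ l v, formA o P t (w l) ((x l).p - y.p) v = 0 := fun l v => by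
    have h1 : elasticForm o P.η t.γ t.ς₂ (w l) v =
        ∑ K, ((x l).p - y.p) K * (P.α * coupling o v (Pi.single K 1)) := by
      simp only [w, map_sum, map_smul, LinearMap.sum_apply, LinearMap.smul_apply, smul_eq_mul]
      refine Finset.sum_congr rfl fun K _ => ?_
      have := hU K v
      rw [formA_eq] at this
      rw [sub_eq_zero.1 this]
    have h2 : coupling o v ((x l).p - y.p) =
        ∑ K, ((x l).p - y.p) K * coupling o v (Pi.single K 1) := by
      conv_lhs => rw [pi_eq_sum_univ' ((x l).p - y.p)]
      simp only [map_sum, map_smul, smul_eq_mul]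
    rw [formA_eq, h1, h2, Finset.mul_sum, ← Finset.sum_sub_distrib]
    exact Finset.sum_eq_zero fun K _ => by ring
  refine ⟨fun l => (x l).us - y.us - w l, fun l => B.rigid _ fun v => ?_, ?_⟩
  · have h3 : (0 : P0 M) = (x l).p - y.p - ((x l).p - y.p) := (sub_self _).symm
    rw [h3, formA_sub, formA_sub, hx, hy, hw]
    ring
  · have h4 : ∀ l, l2SqV ((x l).us - ((x l).us - y.us - w l) - y.us) =
        ∑ K, ∑ L, ((x l).p - y.p) K * (((x l).p - y.p) L * l2Form (U K) (U L)) := fun l => by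
      have h5 : (x l).us - ((x l).us - y.us - w l) - y.us = w l := by abel
      rw [h5, l2SqV_eq]
      simp only [w, map_sum, map_smul, LinearMap.sum_apply, LinearMap.smul_apply, smul_eq_mul,
        Finset.mul_sum]
      rw [Finset.sum_comm]
      exact Finset.sum_congr rfl fun K _ => Finset.sum_congr rfl fun L _ => by ring
    simp only [h4]
    have := tendsto_finsetSum (Finset.univ : Finset (Elem M)) fun K _ =>
      tendsto_finsetSum (Finset.univ : Finset (Elem M)) fun L _ =>
        (hp K).mul ((hp L).mul_const (l2Form (U K) (U L)))
    simpa using this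

/-- All unknowns converge as soon as the potentials do. -/
theorem Regime.convergesTo (R : Regime o P t old k) {x : ℕ → Level M} {y : Level M}
    (hx : ∀ l, Constitutive o P t old (x l)) (hy : Constitutive o P t old y)
    (h : Tendsto (fun l => l2SqQ ((x l).mu - y.mu)) atTop (𝓝 0)) : ConvergesTo o x y := by
  have hp : Tendsto (fun l => l2SqQ ((x l).p - y.p)) atTop (𝓝 0) :=
    squeeze_zero (fun l => l2SqQ_nonneg _) (fun l => R.pressure_sub_le (hx l) hy)
      (by simpa using h.const_mul (k.c₁ ^ 2))
  refine ⟨R.elastic.tendsto_displacement (fun l => (hx l).momentum) hy.momentum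
    (tendsto_apply_of_l2SqQ hp), ?_, hp, ?_, h, ?_⟩
  · refine squeeze_zero (fun l => ?_) (fun l => (R.step.le_darcy _).trans
      (mul_le_mul_of_nonneg_left (R.darcy_le_jump ((hx l).darcy_sub hy)) R.ω_pos.le)) ?_
    · rw [l2SqV_eq]
      exact l2Form_nonneg _
    · simpa using ((tendsto_jumpProd o (tendsto_apply_of_l2SqQ h)).const_mul k.H).const_mul k.ω
  · exact squeeze_zero (fun l => l2SqQ_nonneg _) (fun l => R.density_sub_le (hx l) hy)
      (by simpa using h.const_mul (k.s₁ ^ 2))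
  · refine squeeze_zero (fun l => l2SqQ_nonneg _) (fun l => R.porosity_sub_le (hx l) hy) ?_
    simpa using (h.const_mul (k.c₁ ^ 2)).const_mul ((1 / t.N + k.C / t.γ) ^ 2)

theorem Regime.l2SqQ_le_energyDist (R : Regime o P t old k) (x y : Level M) :
    l2SqQ (x.mu - y.mu) ≤ 2 / k.a * energyDist P t old k x y := by
  have ha := R.a_pos
  have h1 := mul_nonneg R.τ_pos.le (R.step.darcy_nonneg (x.uf - y.uf))
  have e : l2SqQ (x.mu - y.mu) = 2 / k.a * (k.a / 2 * l2SqQ (x.mu - y.mu)) := by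
    field_simp
  rw [e]
  refine mul_le_mul_of_nonneg_left ?_ (by positivity)
  rw [energyDist]
  linarith

theorem Regime.energyDist_nonneg (R : Regime o P t old k) (x y : Level M) :
    0 ≤ energyDist P t old k x y := by
  have ha := R.a_pos
  have h1 := mul_nonneg R.τ_pos.le (R.step.darcy_nonneg (x.uf - y.uf))
  have h2 := mul_nonneg ha.le (l2SqQ_nonneg (x.mu - y.mu))
  rw [energyDist]
  linarith

theorem tendsto_of_halving {f : ℕ → ℝ} (h0 : ∀ l, 0 ≤ f l) (h : ∀ l, f (l + 1) ≤ 1 / 2 * f l) :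
    (∀ l, f l ≤ (1 / 2) ^ l * f 0) ∧ Tendsto f atTop (𝓝 0) := by
  have h1 : ∀ l, f l ≤ (1 / 2) ^ l * f 0 := fun l => by
    induction l with
    | zero => simp
    | succ l ih =>
      rw [pow_succ]
      linarith [h l]
  refine ⟨h1, squeeze_zero h0 h1 ?_⟩
  have := (tendsto_pow_atTop_nhds_zero_of_lt_one (by norm_num : (0 : ℝ) ≤ 1 / 2)
    (by norm_num)).mul_const (f 0)
  simpa using this

theorem Admissible.phi_lower (R : Regime o P t old k) {x : Level M}
    (h : Admissible o P t old k x) (K : Elem M) : k.φ₀ ≤ x.phi K := by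
  have := abs_le.1 (h.phi K)
  linarith [R.phi_lower K]

theorem Regime.admissible_of_isIteration (R : Regime o P t old k) {x : ℕ → Level M}
    (h0 : Admissible o P t old k (x 0)) (hx : IsIteration o P t old x) :
    ∀ l, Admissible o P t old k (x l) := by
  intro l
  induction l with
  | zero => exact h0
  | succ l ih =>
    obtain ⟨hc, hm⟩ := (R.step.equations_iff R.τ_pos _ _).1 (hx l)
    exact (R.admissible_next ih hc hm).1

theorem Regime.exists_isIteration (R : Regime o P t old k) {x₀ : Level M}
    (h0 : Admissible o P t old k x₀) :
    ∃ x : ℕ → Level M, x 0 = x₀ ∧ IsIteration o P t old x := by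
  have hstep : ∀ x : {x : Level M // Admissible o P t old k x},
      ∃ x' : {x : Level M // Admissible o P t old k x}, Equations o P t old x.1 x'.1 := by
    rintro ⟨x, hx⟩
    obtain ⟨x', hx'⟩ := R.exists_step x hx.phi
    obtain ⟨hc, hm⟩ := (R.step.equations_iff R.τ_pos _ _).1 hx'
    exact ⟨⟨x', (R.admissible_next hx hc hm).1⟩, hx'⟩
  choose g hg using hstep
  refine ⟨fun l => (g^[l] ⟨x₀, h0⟩).1, rfl, fun l => ?_⟩
  simp only [Function.iterate_succ_apply']
  exact hg _

/-- The limit of the iteration started from `φⁿ` with zero velocity solves the nonlinear system.  This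
initial guess is admissible for every time step. -/
theorem Regime.exists_solution (R : Regime o P t old k) :
    ∃ y, IsSolution o P t old y ∧ (∀ K, |y.phi K - old.phi K| ≤ k.Cε) ∧
      ∀ K, |y.c K| ≤ k.cBound (totalVol M) := by
  have hY : 0 ≤ k.Y := by
    have ha := R.a_pos
    have hV := totalVol_nonneg M
    refine le_trans ?_ R.Y_ge
    rw [Constants.D]
    positivity
  have h0 : Admissible o P t old k ⟨0, 0, 0, 0, 0, old.phi⟩ :=
    ⟨fun K => by simpa using R.Cε_pos.le, by simpa using hY⟩
  obtain ⟨x, hx0, hx⟩ := R.exists_isIteration h0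
  have hadm := R.admissible_of_isIteration (hx0.symm ▸ h0) hx
  have hcm := fun l => (R.step.equations_iff R.τ_pos _ _).1 (hx l)
  have hcb : ∀ l K, |(x (l + 1)).c K| ≤ k.cBound (totalVol M) := fun l =>
    R.density_le (hcm l).1 (R.admissible_next (hadm l) (hcm l).1 (hcm l).2).2
  obtain ⟨hdec, -⟩ := tendsto_of_halving (f := fun l =>
      energyDist P t old k (x (l + 2)) (x (l + 1)))
    (fun l => R.energyDist_nonneg _ _) (fun l =>
      R.stability ((hadm (l + 2)).phi_lower R) (hcb (l + 1)) (hcm (l + 1)).1 (hcm l).1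
        (hcm (l + 2)).1 (hcm (l + 1)).1 (hcm (l + 2)).2 (hcm (l + 1)).2)
  set Z₀ := energyDist P t old k (x 2) (x 1) with hZ₀
  have hZ₀' : 0 ≤ Z₀ := R.energyDist_nonneg _ _
  have ha := R.a_pos
  have hcauchy : ∀ K, CauchySeq fun l => (x (l + 1)).mu K := fun K => by
    refine cauchySeq_of_le_geometric (Real.sqrt (1 / 2)) (Real.sqrt (2 / k.a * Z₀ / vol K)) ?_
      fun l => ?_
    · rw [Real.sqrt_lt' one_pos]
      norm_num
    · rw [dist_comm, Real.dist_eq]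
      have hv := vol_pos K
      have e : Real.sqrt (2 / k.a * Z₀ / vol K) * Real.sqrt (1 / 2) ^ l =
          Real.sqrt (2 / k.a * Z₀ / vol K * (1 / 2) ^ l) := by
        rw [Real.sqrt_mul (by positivity)]
        congr 1
        refine ((Real.sqrt_eq_iff_eq_sq (by positivity) (by positivity)).2 ?_).symm
        rw [← pow_mul, mul_comm, pow_mul, Real.sq_sqrt (by norm_num)]
      rw [e]
      refine Real.abs_le_sqrt ?_
      have h1 := mul_sq_le_l2SqQ ((x (l + 2)).mu - (x (l + 1)).mu) K
      have h2 := R.l2SqQ_le_energyDist (x (l + 2)) (x (l + 1))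
      have h3 := mul_le_mul_of_nonneg_left (hdec l) (by positivity : (0 : ℝ) ≤ 2 / k.a)
      rw [div_mul_eq_mul_div, le_div_iff₀ hv]
      calc ((x (l + 2)).mu K - (x (l + 1)).mu K) ^ 2 * vol K
          = vol K * ((x (l + 2)).mu - (x (l + 1)).mu) K ^ 2 := by
            rw [Pi.sub_apply]
            ring
        _ ≤ 2 / k.a * ((1 / 2) ^ l * Z₀) := h1.trans (h2.trans h3)
        _ = 2 / k.a * Z₀ * (1 / 2) ^ l := by ring
  choose μ hμ using fun K => cauchySeq_tendsto_of_complete (hcauchy K)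
  obtain ⟨y, hyμ, hy⟩ := R.exists_constitutive μ
  have hmu : ∀ K, Tendsto (fun l => ((x (l + 1)).mu - y.mu) K) atTop (𝓝 0) := fun K => by
    rw [hyμ]
    simpa using (hμ K).sub_const (μ K)
  have hconv := R.convergesTo (fun l => (hcm l).1) hy (tendsto_l2SqQ hmu)
  have hphi : ∀ K, Tendsto (fun l => (x (l + 1)).phi K) atTop (𝓝 (y.phi K)) := fun K =>
    tendsto_sub_nhds_zero_iff.1 (tendsto_apply_of_l2SqQ hconv.phi K)
  have hc : ∀ K, Tendsto (fun l => (x (l + 1)).c K) atTop (𝓝 (y.c K)) := fun K =>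
    tendsto_sub_nhds_zero_iff.1 (tendsto_apply_of_l2SqQ hconv.c K)
  have hu : ∀ q, Tendsto (fun l => convection o old q (x (l + 1)).uf) atTop
      (𝓝 (convection o old q y.uf)) := fun q => by
    refine tendsto_sub_nhds_zero_iff.1 (tendsto_of_sq_le
      (g := fun l => k.H * jumpProd o ((x (l + 1)).mu - y.mu) ((x (l + 1)).mu - y.mu))
      (r := k.H * jumpProd o q q) (fun l => ?_) ?_)
    · rw [← map_sub]
      exact (R.step.convection_sq_le q _).trans (mul_le_mul_of_nonneg_left
        (R.darcy_le_jump ((hcm l).1.darcy_sub hy))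
        (mul_nonneg R.H_pos.le (jumpProd_nonneg o q)))
    · simpa using (tendsto_jumpProd o hmu).const_mul k.H
  refine ⟨y, (R.step.equations_iff R.τ_pos _ _).2 ⟨hy, fun q => ?_⟩, fun K => ?_, fun K => ?_⟩
  · have h1 : Tendsto (fun l => qForm ((x (l + 1)).phi * (x (l + 2)).c - old.phi * old.c) q)
        atTop (𝓝 (qForm (y.phi * y.c - old.phi * old.c) q)) := by
      simp only [qForm_apply, Pi.sub_apply, Pi.mul_apply]
      exact tendsto_finsetSum _ fun K _ => ((((hphi K).mul
        ((hc K).comp (tendsto_add_atTop_nat 1))).sub_const _).mul_const _).const_mul _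
    have h2 : Tendsto (fun l => jumpProd o (x (l + 2)).mu q) atTop (𝓝 (jumpProd o y.mu q)) := by
      have hm : ∀ K, Tendsto (fun l => (x (l + 2)).mu K) atTop (𝓝 (y.mu K)) := fun K =>
        (tendsto_sub_nhds_zero_iff.1 (hmu K)).comp (tendsto_add_atTop_nat 1)
      simp only [jumpProd_apply, jumpQ]
      exact tendsto_finsetSum _ fun e _ => ((hm _).sub (hm _)).mul_const _
    have h3 := h1.add (((hu q).add (h2.const_mul t.ς₁)).const_mul t.τ)
    refine tendsto_nhds_unique h3 ?_
    simp only [(hcm (_ + 1)).2 q]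
    exact tendsto_const_nhds
  · exact le_of_tendsto ((hphi K).sub_const _).abs
      (Eventually.of_forall fun l => (hadm (l + 1)).phi K)
  · exact le_of_tendsto (hc K).abs (Eventually.of_forall fun l => hcb l K)

theorem Regime.agree_of_energyDist (R : Regime o P t old k) {y z : Level M}
    (hy : Constitutive o P t old y) (hz : Constitutive o P t old z)
    (h : energyDist P t old k z y ≤ 0) : AgreeModRigid o z y := by
  have hmu0 : l2SqQ (z.mu - y.mu) ≤ 0 := by
    have ha := R.a_pos
    exact (R.l2SqQ_le_energyDist z y).trans (mul_nonpos_of_nonneg_of_nonpos (by positivity) h)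
  have hmu : z.mu - y.mu = 0 := eq_zero_of_l2SqQ _ hmu0
  have hmu' := le_antisymm hmu0 (l2SqQ_nonneg _)
  have hp : z.p - y.p = 0 := eq_zero_of_l2SqQ _ (by
    have := R.pressure_sub_le hz hy
    rwa [hmu', mul_zero] at this)
  refine ⟨R.elastic.rigid _ fun v => ?_, sub_eq_zero.1 hp, sub_eq_zero.1 ?_,
    sub_eq_zero.1 (eq_zero_of_l2SqQ _ ?_), sub_eq_zero.1 hmu,
    sub_eq_zero.1 (eq_zero_of_l2SqQ _ ?_)⟩
  · rw [← hp, formA_sub, hz.momentum, hy.momentum, sub_zero]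
  · refine eq_zero_of_l2Form _ (le_antisymm ?_ (l2Form_nonneg _))
    have h1 := R.step.le_darcy (z.uf - y.uf)
    rwa [hz.darcy_sub hy, hmu, map_zero, LinearMap.zero_apply, mul_zero, l2SqV_eq] at h1
  · have := R.density_sub_le hz hy
    rwa [hmu', mul_zero] at this
  · have := R.porosity_sub_le hz hy
    rwa [hmu', mul_zero, mul_zero] at this

/-- Uniqueness is stability of a step in which both levels are their own lag. -/
theorem Regime.unique (R : Regime o P t old k) {y z : Level M} (hy : IsSolution o P t old y)
    (hz : IsSolution o P t old z)
    (h : ((∀ K, k.φ₀ ≤ z.phi K) ∧ ∀ K, |y.c K| ≤ k.cBound (totalVol M)) ∨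
      ((∀ K, k.φ₀ ≤ y.phi K) ∧ ∀ K, |z.c K| ≤ k.cBound (totalVol M))) :
    AgreeModRigid o z y := by
  obtain ⟨hyc, hym⟩ := (R.step.equations_iff R.τ_pos _ _).1 hy
  obtain ⟨hzc, hzm⟩ := (R.step.equations_iff R.τ_pos _ _).1 hz
  refine R.agree_of_energyDist hyc hzc ?_
  rcases h with ⟨h1, h2⟩ | ⟨h1, h2⟩
  · have h3 : energyDist P t old k z y ≤ 1 / 2 * energyDist P t old k z y :=
      R.stability h1 h2 hzc hyc hzc hyc hzm hym
    linarith
  · have h3 : energyDist P t old k y z ≤ 1 / 2 * energyDist P t old k y z :=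
      R.stability h1 h2 hyc hzc hyc hzc hym hzm
    rw [energyDist_comm]
    linarith

theorem Regime.iteration_converges (R : Regime o P t old k) {x : ℕ → Level M} {y : Level M}
    (hx : IsIteration o P t old x) (h0 : Admissible o P t old k (x 0))
    (hy : IsSolution o P t old y) (hyc : ∀ K, |y.c K| ≤ k.cBound (totalVol M)) :
    ConvergesTo o x y := by
  obtain ⟨hc, hm⟩ := (R.step.equations_iff R.τ_pos _ _).1 hy
  have hadm := R.admissible_of_isIteration h0 hx
  have hcm := fun l => (R.step.equations_iff R.τ_pos _ _).1 (hx l)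
  refine ConvergesTo.of_succ (R.convergesTo (fun l => (hcm l).1) hc ?_)
  obtain ⟨-, hlim⟩ := tendsto_of_halving (f := fun l => energyDist P t old k (x (l + 1)) y)
    (fun l => R.energyDist_nonneg _ _) (fun l =>
      R.stability ((hadm (l + 1)).phi_lower R) hyc (hcm l).1 hc (hcm (l + 1)).1 hc
        (hcm (l + 1)).2 hm)
  exact squeeze_zero (fun l => l2SqQ_nonneg _) (fun l => R.l2SqQ_le_energyDist _ _)
    (by simpa using hlim.const_mul (2 / k.a))

end Limit

theorem exists_sq_mul_le {A B : ℝ} (hA : 0 ≤ A) (hB : 0 < B) :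
    ∃ ε > 0, ∀ κ, 0 ≤ κ → κ ≤ ε → κ ^ 2 * A ≤ B := by
  refine ⟨min 1 (B / (A + 1)), lt_min one_pos (by positivity), fun κ h0 h => ?_⟩
  have h1 : κ ≤ 1 := h.trans (min_le_left _ _)
  have h2 : κ * (A + 1) ≤ B := (le_div_iff₀ (by positivity)).1 (h.trans (min_le_right _ _))
  nlinarith [mul_nonneg h0 hA, mul_nonneg (mul_nonneg h0 hA) (sub_nonneg.2 h1)]

end PoroGas

end

theorem theorem5p2 {d : ℕ} (hd : d = 2 ∨ d = 3) {Ω : Set (PoroGas.E d)}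
    (M : PoroGas.Triangulation d Ω) (o : PoroGas.Orientation M) (P : PoroGas.Physical)
    (ϱ₀ ϱ φmin φmax Cε pmax θmax τmax Umax : ℝ)
    (hϱ₀ : 0 < ϱ₀) (hϱ : ϱ < 1) (hφmin : 0 < φmin) (hφmax : φmax < 1)
    (hCε : 0 < Cε) (hCε_min : Cε < φmin) (hCε_max : Cε < 1 - φmax) :
    ∃ γ₀ > 0, ∃ N₀ > 0, ∃ ς₁₀ > 0, ∀ γ ≥ γ₀, ∃ ς₂₀ > 0,
      ∀ N ≥ N₀, ∀ ς₁ ≥ ς₁₀, ∀ ς₂ ≥ ς₂₀, ∀ τ > 0, ∀ θ : ℝ, 1 ≤ θ → θ ≤ θmax →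
      ∀ t : PoroGas.Tuning,
        t = { γ := γ, N := N, ς₁ := ς₁, ς₂ := ς₂, τ := τ, θ := θ } →
      ∀ old : PoroGas.Level M,
        PoroGas.IsPreviousLevel o P t ϱ₀ ϱ φmin φmax pmax old →
      ∃ y : PoroGas.Level M,
        PoroGas.IsSolution o P t old y ∧
        (∀ K, |y.phi K - old.phi K| ≤ Cε) ∧
        (∀ z : PoroGas.Level M, PoroGas.IsSolution o P t old z →
          ((∀ K, old.phi K - Cε ≤ z.phi K) ∨ (∀ K, 0 < z.c K ∧ z.c K < 1 / P.β)) →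
          PoroGas.AgreeModRigid o z y) ∧
        (τ ≤ τmax →
          ∀ x₀ : PoroGas.Level M, (∀ K, |x₀.phi K - old.phi K| ≤ Cε) →
            x₀.uf ∈ PoroGas.RT0 M → PoroGas.l2SqV x₀.uf ≤ Umax ^ 2 →
            (∃ x : ℕ → PoroGas.Level M, x 0 = x₀ ∧ PoroGas.IsIteration o P t old x) ∧
            (∀ x : ℕ → PoroGas.Level M, x 0 = x₀ → PoroGas.IsIteration o P t old x →
              (∀ l K, |(x l).phi K - old.phi K| ≤ Cε) ∧ PoroGas.ConvergesTo o x y)) := by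

  have : NeZero d := ⟨by omega⟩
  obtain ⟨s₀, hs₀, s₁, hs₁, m, hm, H, hH, ω, hω, hstep⟩ :=
    PoroGas.exists_stepBounds (φmin := φmin) (φmax := φmax) (pmax := pmax) (θmax := θmax) o P
      hϱ₀ hϱ hφmin hφmax
  obtain ⟨C, hC, hel⟩ := PoroGas.exists_elasticBounds o P
  obtain ⟨v, hv, hvK⟩ := PoroGas.exists_vol_lower M
  have hβ := P.β_pos
  have hφ₀ : 0 < φmin - Cε := by linarith
  have hV := PoroGas.totalVol_nonneg M
  -- `Y` bounds `τ (λ⁻¹ u_f, u_f)` for the initial guesses of the third assertion.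
  let D := (s₁ * m + 1 / P.β) ^ 2 / (2 * ((φmin - Cε) * s₀))
  let Y := PoroGas.totalVol M * D + ω * max τmax 0 * Umax ^ 2
  let k : PoroGas.Constants := ⟨s₀, s₁, 1 / P.β, m, H, ω, C, φmin - Cε, Cε, Y, v⟩
  have ha : 0 < k.a := mul_pos hφ₀ hs₀
  have hD : 0 ≤ D := div_nonneg (sq_nonneg _) (mul_pos two_pos ha).le
  have hYU : 0 ≤ ω * max τmax 0 * Umax ^ 2 :=
    mul_nonneg (mul_nonneg hω.le (le_max_right _ _)) (sq_nonneg _)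
  have hY : 0 ≤ Y := add_nonneg (mul_nonneg hV hD) hYU
  have hmu : 0 ≤ k.muBound (PoroGas.totalVol M) :=
    mul_nonneg (div_nonneg two_pos.le ha.le)
      (add_nonneg (mul_nonneg hV hD) (div_nonneg hY two_pos.le))
  have hp : 0 ≤ k.pBound (PoroGas.totalVol M) :=
    mul_nonneg (by norm_num) (add_nonneg (mul_nonneg (sq_nonneg _) hmu)
      (mul_nonneg hV (mul_nonneg two_pos.le (sq_nonneg _))))
  have hcB : 1 / P.β ≤ k.cBound (PoroGas.totalVol M) :=
    le_add_of_nonneg_right (mul_nonneg hs₁.le (add_nonneg (Real.sqrt_nonneg _) hm))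
  obtain ⟨ε₁, hε₁, h₁⟩ := PoroGas.exists_sq_mul_le hp
    (mul_pos hv (pow_pos hCε 2) : 0 < k.v * k.Cε ^ 2)
  obtain ⟨ε₂, hε₂, h₂⟩ := PoroGas.exists_sq_mul_le
    (by positivity : 0 ≤ k.c₁ ^ 2 * k.cBound (PoroGas.totalVol M) ^ 2 / (2 * k.a))
    (by positivity : 0 < k.a / 4)
  have hε : 0 < min ε₁ ε₂ := lt_min hε₁ hε₂
  -- With these thresholds each summand of `1 / N + C / γ` is at most half of `min ε₁ ε₂`.
  refine ⟨2 * (C + 1) / min ε₁ ε₂, by positivity, 2 / min ε₁ ε₂, by positivity, 2 * H,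
    by positivity, fun γ hγ => ?_⟩
  have hγ0 : 0 < γ := lt_of_lt_of_le (by positivity) hγ
  obtain ⟨ς₀, hς₀, hel⟩ := hel γ hγ0
  refine ⟨ς₀, hς₀, fun N hN ς₁ hς₁ ς₂ hς₂ τ hτ θ hθ hθm t ht old hold => ?_⟩
  have hN0 : 0 < N := lt_of_lt_of_le (by positivity) hN
  have hκ0 : 0 ≤ 1 / N + C / γ := by positivity
  have hκ : 1 / N + C / γ ≤ min ε₁ ε₂ := by
    have h3 : 1 / N ≤ min ε₁ ε₂ / 2 := by
      rw [ge_iff_le, div_le_iff₀ hε] at hN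
      rw [div_le_iff₀ hN0]
      linarith
    have h4 : C / γ ≤ min ε₁ ε₂ / 2 := by
      rw [ge_iff_le, div_le_iff₀ hε] at hγ
      rw [div_le_iff₀ hγ0]
      linarith
    linarith
  subst ht
  have R : PoroGas.Regime o P ⟨γ, N, ς₁, ς₂, τ, θ⟩ old k :=
    { step := hstep _ hθ hθm old hold
      elastic := hel _ rfl hς₂
      momentum := hold.momentum
      phi_lower := fun K => by
        have := (hold.porosity K).1
        change φmin - Cε + Cε ≤ old.phi K
        linarith
      phi_upper := fun K => by
        have := (hold.porosity K).2
        change old.phi K + Cε ≤ 1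
        linarith
      v_le := hvK
      s₀_pos := hs₀
      s₁_pos := hs₁
      H_pos := hH
      ω_pos := hω
      C_nonneg := hC
      φ₀_pos := hφ₀
      Cε_pos := hCε
      v_pos := hv
      τ_pos := hτ
      γ_pos := hγ0
      N_pos := hN0
      ς_ge := hς₁
      Y_ge := le_add_of_nonneg_right hYU
      small_porosity := h₁ _ hκ0 (hκ.trans (min_le_left _ _))
      small_contraction := h₂ _ hκ0 (hκ.trans (min_le_right _ _)) }
  obtain ⟨y, hy, hyφ, hyc⟩ := R.exists_solution
  refine ⟨y, hy, hyφ, fun z hz hcase => R.unique hy hz ?_, fun hτm x₀ hx₀ _ hxU => ?_⟩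
  · refine hcase.imp (fun h => ⟨fun K => ?_, hyc⟩) (fun h => ⟨fun K => ?_, fun K => ?_⟩)
    · have h3 := h K
      have h4 := (hold.porosity K).1
      change φmin - Cε ≤ z.phi K
      linarith
    · have h3 := abs_le.1 (hyφ K)
      have h4 := (hold.porosity K).1
      change -Cε ≤ y.phi K - old.phi K ∧ _ at h3
      change φmin - Cε ≤ y.phi K
      linarith [h3.1]
    · rw [abs_of_pos (h K).1]
      exact (h K).2.le.trans hcB
  · have hadm : PoroGas.Admissible o P ⟨γ, N, ς₁, ς₂, τ, θ⟩ old k x₀ := by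
      refine ⟨hx₀, ?_⟩
      change τ * PoroGas.darcyForm P old x₀.uf x₀.uf ≤ Y
      have h3 := R.step.darcy_le x₀.uf
      calc τ * PoroGas.darcyForm P old x₀.uf x₀.uf ≤ max τmax 0 * (ω * Umax ^ 2) :=
            mul_le_mul (hτm.trans (le_max_left _ _))
              (h3.trans (mul_le_mul_of_nonneg_left hxU hω.le)) (R.step.darcy_nonneg _)
              (le_max_right _ _)
        _ = ω * max τmax 0 * Umax ^ 2 := by ring
        _ ≤ Y := le_add_of_nonneg_left (mul_nonneg hV hD)
    refine ⟨R.exists_isIteration hadm, fun x hx0 hx => ?_⟩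
    subst hx0
    exact ⟨fun l => (R.admissible_of_isIteration hadm hx l).phi,
      R.iteration_converges hx hadm hy hyc⟩
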